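/- Let $S$ be a finite set. Consider the relational language with one $k$-ary predicate symbol $R_{\bar s}$ for every finite tuple $\bar s\in S^k$, together with the metric symbol $d$. In this language a (relational) metric structure is a complete metric space $(T,d)$ with a uniformly continuous function $R_{\bar s}\colon T^k\to\mathbb R$ for each $\bar s\in S^k$. Embeddings are maps preserving the values of all predicates, including $d$; isomorphisms are surjective embeddings. A metric structure $T$ is a non-degenerate $S$-valued stochastic process if the functions $F_{\bar t}(\bar s)=R_{\bar s}(\bar t)$ (the finite-dimensional distributions $\mathbb P(X(\bar t)=\bar s)$) satisfy, for all tuples, $F_{\bar t}(\bar s)\in[0,1]$, $\sum_{\bar s\in S^k}F_{\bar t}(\bar s)=1$, $\sum_{z\in S}F_{\bar t,t'}(\bar s,z)=F_{\bar t}(\bar s)$, $F_{\sigma(\bar t)}(\sigma(\bar s))=F_{\bar t}(\bar s)$ for every permutation $\sigma$, and $d(t_1,t_2)=1-\sum_{s\in S}F_{t_1,t_2}(s,s)$, i.e. $d(t_1,t_2)=\mathbb P(X(t_1)\ne X(t_2))$. Let $\mathcal K$ be the class of all finite non-degenerate $S$-valued stochastic processes. For $n\ge 0$ let $\mathcal K_n$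 be the collection of enumerated structures of length $n$, i.e. of $n$-tuples (repetitions allowed) of points of members of $\mathcal K$. For $\bar a,\bar b\in\mathcal K_n$ let $d_{\mathcal K}(\bar a,\bar b)$ be the infimum of $\max_i d(a_i',b_i')$ over all images $\bar a',\bar b'$ of $\bar a,\bar b$ under embeddings into a common member of $\mathcal K$. Let $d_\infty(\bar a,\bar b)=\max|P(\bar a_X)-P(\bar b_X)|$ over all index sets $X\subseteq\{1,\dots,n\}$ and all predicates $P$ of arity $|X|$, including $d$. Let $d_\infty^{\mathrm{fd}}(\bar a,\bar b)\le d_\infty(\bar a,\bar b)$ be the same maximum over the predicates $R_{\bar s}$ only. **Theorem.** The class $\mathcal K$ has the following properties. 1. HP: every finite structure that embeds in a member of $\mathcal K$ is in $\mathcal K$. 2. JEP: any two members of $\mathcal K$ embed in a third. 3. bAP: for every $n\ge 0$ there is a constant $c$, depending only on $n$ (and $S$), such that for all $(\bar a,w),(\bar a,z)\in\mathcal K_{n+1}$ with common part $\bar a$ of length $n$ there is a joint embedding $(\bar a,w,z)$ of them in a member of $\mathcal K$, respecting $\bar a$, with $d(w,z)\le c\,d_\infty((\bar a,w),(\bar a,z))$.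 More precisely, it can be chosen so that $d(w,z)\le\frac12|S|^{n+1}d_\infty^{\mathrm{fd}}((\bar a,w),(\bar a,z))$. 4. PP: for every $n$, $d_{\mathcal K}$ is a pseudometric on $\mathcal K_n$, and $\mathcal K_n$ is separable and complete with respect to it. Moreover, for all $\bar a,\bar b\in\mathcal K_n$, $d_\infty(\bar a,\bar b)\le n\,d_{\mathcal K}(\bar a,\bar b)$ and $d_{\mathcal K}(\bar a,\bar b)\le|S|^n d_\infty^{\mathrm{fd}}(\bar a,\bar b)$. 5. CP: for every $n$-ary predicate $P$ (including $d$), the map $\bar a\mapsto P(\bar a)$ is continuous on $(\mathcal K_n,d_{\mathcal K})$. Consequently $\mathcal K$ is a Fraïssé class: all its members are finite, and it satisfies HP, JEP, PP, CP and the Amalgamation Property (any two embeddings $A\to B$, $A\to C$ in $\mathcal K$ can be completed to a commutative square of embeddings $B\to D$, $C\to D$ with $D\in\mathcal K$). Moreover $\mathcal K$ has a unique Fraïssé limit, as follows. By a $\mathcal K$-structure we mean a metric structure all of whose finite substructures are in $\mathcal K$. There is a separable (complete) $\mathcal K$-structure $M$ such that for every $B\in\mathcal K$, every finite tuple $\bar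 a$ of points of $B$ and every embedding $h\colon\bar a\to M$ there is an embedding $f\colon B\to M$ with $f(\bar a)=h(\bar a)$. This $M$ is ultrahomogeneous (every embedding of a finite subset of $M$ in $M$ extends to an automorphism of $M$), and every separable $\mathcal K$-structure embeds in it. It is unique up to isomorphism, even among approximate limits: $M$ is isomorphic to every separable $\mathcal K$-structure $N$ such that for all $B$, $\bar a$, $h\colon\bar a\to N$ as above and all $\varepsilon>0$ there is an embedding $f\colon B\to N$ with $\max_i d(f(a_i),h(a_i))<\varepsilon$. -/

import Mathlib

universe u v

/-- The predicate symbols of a relational metric language whose ordinary `n`-ary symbols are the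
elements of `L n`: these symbols, together with the distinguished binary symbol `d`. -/
inductive PredSymbol (L : ℕ → Type v) : ℕ → Type v
  | rel {n : ℕ} (R : L n) : PredSymbol L n
  | d : PredSymbol L 2

/-- A (relational) `L`-structure: a complete metric space together with a uniformly continuous
real-valued interpretation of every predicate symbol. -/
structure MetricStructure (L : ℕ → Type v) : Type (max (u + 1) v) where
  carrier : Type u
  [metricSpace : MetricSpace carrier]
  [completeSpace : CompleteSpace carrier]
  interp : ∀ {n : ℕ}, L n → (Fin n → carrier) → ℝ
  uniformContinuous_interp : ∀ {n : ℕ} (R : L n), UniformContinuous (interp R)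

namespace MetricStructure

variable {L : ℕ → Type v}

instance : CoeSort (MetricStructure.{u, v} L) (Type u) := ⟨carrier⟩

instance (M : MetricStructure.{u, v} L) : MetricSpace M := M.metricSpace

instance (M : MetricStructure.{u, v} L) : CompleteSpace M := M.completeSpace

/-- The value of a predicate symbol (possibly `d`) at a tuple of points of `M`. -/
def eval (M : MetricStructure.{u, v} L) : ∀ {n : ℕ}, PredSymbol L n → (Fin n → M) → ℝ
  | _, .rel R, t => M.interp R t
  | _, .d, t => dist (t 0) (t 1)

/-- An embedding of `L`-structures: a map preserving the values of all predicates, including `d`. -/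
def IsEmbedding {M N : MetricStructure.{u, v} L} (φ : M → N) : Prop :=
  ∀ (n : ℕ) (P : PredSymbol L n) (t : Fin n → M), N.eval P (φ ∘ t) = M.eval P t

/-- An isomorphism is a surjective embedding. -/
def IsIsomorphism {M N : MetricStructure.{u, v} L} (φ : M → N) : Prop :=
  IsEmbedding φ ∧ Function.Surjective φ

/-- `M` embeds in `N`, that is, `M` is a substructure of `N`. -/
def Embeds (M N : MetricStructure.{u, v} L) : Prop :=
  ∃ φ : M → N, IsEmbedding φ

/-- For families `x` of points of `M` and `y` of points of `N` with the same index set: the map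
`x i ↦ y i` preserves the values of all predicates (so it is an embedding of the enumerated
structure `x` in `N`, with image `y`). -/
def IsTupleEmbedding {M N : MetricStructure.{u, v} L} {ι : Type*} (x : ι → M) (y : ι → N) : Prop :=
  ∀ (n : ℕ) (P : PredSymbol L n) (i : Fin n → ι), N.eval P (y ∘ i) = M.eval P (x ∘ i)

/-- Every embedding in `M` of a finite subset of `M` extends to an automorphism of `M`. -/
def IsUltrahomogeneous (M : MetricStructure.{u, v} L) : Prop :=
  ∀ (A : Set M), A.Finite → ∀ φ : A → M, IsTupleEmbedding (fun a : A => (a : M)) φ →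
    ∃ f : M → M, IsIsomorphism f ∧ ∀ a : A, f a = φ a

end MetricStructure

/-- A class of `L`-structures. -/
abbrev StructureClass (L : ℕ → Type v) := Set (MetricStructure.{u, v} L)

namespace StructureClass

open MetricStructure

variable {L : ℕ → Type v}

/-- `M` is a `K`-structure: all finite substructures of `M` are in `K`. -/
def IsStructure (K : StructureClass.{u, v} L) (M : MetricStructure.{u, v} L) : Prop :=
  ∀ A : MetricStructure.{u, v} L, Finite A → A.Embeds M → A ∈ K

/-- HP, the Hereditary Property. -/
def HP (K : StructureClass.{u, v} L) : Prop :=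
  ∀ A ∈ K, K.IsStructure A

/-- JEP, the Joint Embedding Property. -/
def JEP (K : StructureClass.{u, v} L) : Prop :=
  ∀ A ∈ K, ∀ B ∈ K, ∃ C ∈ K, A.Embeds C ∧ B.Embeds C

/-- AP, the Amalgamation Property. -/
def AP (K : StructureClass.{u, v} L) : Prop :=
  ∀ A ∈ K, ∀ B ∈ K, ∀ C ∈ K, ∀ (fB : A → B) (fC : A → C), IsEmbedding fB → IsEmbedding fC →
    ∃ D ∈ K, ∃ (gB : B → D) (gC : C → D), IsEmbedding gB ∧ IsEmbedding gC ∧ gB ∘ fB = gC ∘ fC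

/-- `K_n`: the enumerated structures of length `n`, that is, the `n`-tuples (repetitions allowed)
of points of members of `K`. -/
structure Enumerated (K : StructureClass.{u, v} L) (n : ℕ) where
  str : MetricStructure.{u, v} L
  mem : str ∈ K
  tuple : Fin n → str

/-- `d_K(a, b)`: the infimum, over all members `C` of `K` and all images `a'`, `b'` of `a`, `b`
under embeddings in `C`, of `max_i d(a'_i, b'_i)` (which is the distance in `Fin n → C`). -/
noncomputable def dK (K : StructureClass.{u, v} L) {n : ℕ} (a b : K.Enumerated n) : ℝ :=
  sInf {r : ℝ | ∃ C ∈ K, ∃ a' b' : Fin n → C,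
    IsTupleEmbedding a.tuple a' ∧ IsTupleEmbedding b.tuple b' ∧ r = dist a' b'}

/-- `d_∞(a, b)`: the largest difference `|P(a_X) - P(b_X)|`, over all `m`-element sets `X` of
indices and all `m`-ary predicates `P` (including `d`); `a_X` lists the entries of `a` with index in
`X` in increasing order of the indices, i.e. along an order embedding. -/
noncomputable def dInf {K : StructureClass.{u, v} L} {n : ℕ} (a b : K.Enumerated n) : ℝ :=
  sSup {r : ℝ | ∃ (m : ℕ) (X : Fin m ↪o Fin n) (P : PredSymbol L m),
    r = |a.str.eval P (a.tuple ∘ X) - b.str.eval P (b.tuple ∘ X)|}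

/-- One-point amalgamation in `K` with a bound on the distance of the amalgamated points, for
enumerated structures `x = (a, w)` and `y = (a, z)` of length `n + 1`: the common part `a` is given
by the first `n` entries, and `x` and `y` are mapped to `(t, w)` and `(t, z)` in a member `B` of
`K`, where `d(w, z) ≤ bound x y`. -/
def BoundedAmalgamation (K : StructureClass.{u, v} L) (n : ℕ)
    (bound : K.Enumerated (n + 1) → K.Enumerated (n + 1) → ℝ) : Prop :=
  ∀ x y : K.Enumerated (n + 1),
    IsTupleEmbedding (fun i : Fin n => x.tuple i.castSucc) (fun i : Fin n => y.tuple i.castSucc) →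
    ∃ B ∈ K, ∃ (t : Fin n → B) (w z : B),
      IsTupleEmbedding x.tuple (Fin.snoc t w : Fin (n + 1) → B) ∧
      IsTupleEmbedding y.tuple (Fin.snoc t z : Fin (n + 1) → B) ∧
      dist w z ≤ bound x y

/-- bAP, the bounded Amalgamation Property: the constant `c` depends only on the length. -/
def BAP (K : StructureClass.{u, v} L) : Prop :=
  ∀ n : ℕ, ∃ c : ℝ, K.BoundedAmalgamation n (fun x y => c * dInf x y)

/-- PP, the Polish Property: `d_K` is a pseudometric on each `K_n`, and `K_n` is separable and
complete for it. -/
def PP (K : StructureClass.{u, v} L) : Prop :=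
  ∀ n : ℕ, ∃ _inst : PseudoMetricSpace (K.Enumerated n),
    (∀ a b : K.Enumerated n, dist a b = K.dK a b) ∧
    TopologicalSpace.SeparableSpace (K.Enumerated n) ∧ CompleteSpace (K.Enumerated n)

/-- CP, the Continuity Property: for every `n`-ary predicate symbol `P` (including `d`), the map
`a ↦ P(a)` is continuous on `K_n` with respect to `d_K`. -/
def CP (K : StructureClass.{u, v} L) : Prop :=
  ∀ (n : ℕ) (P : PredSymbol L n) (a : K.Enumerated n) (ε : ℝ), 0 < ε →
    ∃ δ : ℝ, 0 < δ ∧ ∀ b : K.Enumerated n, K.dK a b < δ →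
      |b.str.eval P b.tuple - a.str.eval P a.tuple| < ε

/-- Fraïssé classes of finite `L`-structures. -/
structure IsFraisseClass (K : StructureClass.{u, v} L) : Prop where
  finite : ∀ A ∈ K, Finite A
  hp : K.HP
  jep : K.JEP
  ap : K.AP
  pp : K.PP
  cp : K.CP

/-- The approximate extension property. -/
def ApproxExtension (K : StructureClass.{u, v} L) (M : MetricStructure.{u, v} L) : Prop :=
  ∀ B ∈ K, ∀ (n : ℕ) (a : Fin n → B) (h : Fin n → M), IsTupleEmbedding a h →
    ∀ ε : ℝ, 0 < ε → ∃ f : B → M, IsEmbedding f ∧ ∀ i, dist (f (a i)) (h i) < ε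

/-- The exact extension property. -/
def ExactExtension (K : StructureClass.{u, v} L) (M : MetricStructure.{u, v} L) : Prop :=
  ∀ B ∈ K, ∀ (n : ℕ) (a : Fin n → B) (h : Fin n → M), IsTupleEmbedding a h →
    ∃ f : B → M, IsEmbedding f ∧ ∀ i, f (a i) = h i

/-- Approximate limits of `K`. -/
structure IsApproxLimit (K : StructureClass.{u, v} L) (M : MetricStructure.{u, v} L) : Prop where
  separable : TopologicalSpace.SeparableSpace M
  isStructure : K.IsStructure M
  extension : K.ApproxExtension M

/-- Exact limits of `K`. -/
structure IsExactLimit (K : StructureClass.{u, v} L) (M : MetricStructure.{u, v} L) : Prop where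
  separable : TopologicalSpace.SeparableSpace M
  isStructure : K.IsStructure M
  extension : K.ExactExtension M

/-- `M` is universal for separable `K`-structures. -/
def IsUniversal (K : StructureClass.{u, v} L) (M : MetricStructure.{u, v} L) : Prop :=
  ∀ N : MetricStructure.{u, v} L, TopologicalSpace.SeparableSpace N → K.IsStructure N → N.Embeds M

end StructureClass

/-- The language of `S`-valued stochastic processes: one `k`-ary predicate symbol `R_s` for every
`k`-tuple `s` of states. -/
def processLanguage (S : Type v) : ℕ → Type v := fun k => Fin k → S

/-- `F_t(s) = R_s(t)`, which stands for `ℙ(X(t₁) = s₁, …, X(t_k) = s_k)`. -/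
def MetricStructure.fidi {S : Type v} (T : MetricStructure.{u, v} (processLanguage S)) {k : ℕ}
    (t : Fin k → T) (s : Fin k → S) : ℝ :=
  T.interp (n := k) (show processLanguage S k from s) t

/-- The metric structure `T` is a non-degenerate `S`-valued stochastic process: the functions `F_t`
are the finite-dimensional distributions of a process with index set `T` (they satisfy Kolmogorov's
consistency conditions), and the metric is `d(t₁, t₂) = ℙ(X(t₁) ≠ X(t₂))`. The conditions are
imposed on all tuples, with repetitions allowed; as `d(t, t) = 0`, the last one forces
`F_t(s) = 0` whenever `t i = t j` and `s i ≠ s j`. Non-degeneracy holds because `d` is a metric. -/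
structure IsNondegenerateProcess {S : Type v} [Fintype S]
    (T : MetricStructure.{u, v} (processLanguage S)) : Prop where
  mem_Icc : ∀ {k : ℕ} (t : Fin k → T) (s : Fin k → S), T.fidi t s ∈ Set.Icc (0 : ℝ) 1
  sum_eq_one : ∀ {k : ℕ} (t : Fin k → T), ∑ s : Fin k → S, T.fidi t s = 1
  marginal : ∀ {k : ℕ} (t : Fin k → T) (t' : T) (s : Fin k → S),
    ∑ z : S, T.fidi (Fin.snoc t t' : Fin (k + 1) → T) (Fin.snoc s z : Fin (k + 1) → S) = T.fidi t s
  perm : ∀ {k : ℕ} (σ : Equiv.Perm (Fin k)) (t : Fin k → T) (s : Fin k → S),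
    T.fidi (t ∘ σ) (s ∘ σ) = T.fidi t s
  dist_eq : ∀ t₁ t₂ : T, 1 - ∑ s : S, T.fidi ![t₁, t₂] ![s, s] = dist t₁ t₂

/-- The class of all finite non-degenerate `S`-valued stochastic processes. -/
def finiteProcesses (S : Type v) [Fintype S] : StructureClass.{u, v} (processLanguage S) :=
  {T | Finite T ∧ IsNondegenerateProcess T}

/-- The part of `d_∞(a, b)` coming from the finite-dimensional distributions alone: the largest
difference `|ℙ(X(a_A) = s) - ℙ(X(b_A) = s)|` over all sets `A` of indices and all `s` in `S^A`. -/
noncomputable def fidiDist {S : Type v} [Fintype S] {n : ℕ}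
    (a b : (finiteProcesses.{u, v} S).Enumerated n) : ℝ :=
  sSup {r : ℝ | ∃ (m : ℕ) (A : Fin m ↪o Fin n) (s : Fin m → S),
    r = |a.str.fidi (a.tuple ∘ A) s - b.str.fidi (b.tuple ∘ A) s|}

/-! The limit is explicit: the process of all `S`-valued random variables on the unit interval,
modulo almost sure equality, with d(X, Y) = P(X ≠ Y). Sending the states to vectors at mutual
distance 1 turns it into a closed subset of an L¹ space, hence it is complete and separable.
Everything about the class of finite processes is read off inside this one structure.

The engine is an optimal coupling. Since Lebesgue measure has no atoms, given random variables A, W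
and a prescribed law of (A, Z) whose first marginal is the law of A, there is a Z on the same space
with that law. On each piece {A = t, W = u} one keeps Z = W on as much mass as the prescribed law
allows, so P(W ≠ Z) is at most the sum of the positive parts of the differences of the two laws
(`exists_coupling`). By Kolmogorov consistency the law of a finite tuple determines its isomorphism
type (`isTupleEmbedding_iff`), so a coupling is an embedding. Ignoring W gives exact extension
(`exists_embedding`), hence JEP and AP; using W gives the quantitative bounds, because the positive
part has half the ℓ¹ mass, at most ½|S|ⁿ times the largest difference (`exists_near`). Exact
extension also computes d_K with one of the two tuples fixed (`exists_dist_lt`), from which the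
triangle inequality and completeness follow.

Exact limits are ultrahomogeneous, universal and unique by back-and-forth along countable dense
sets. An approximate limit is exact: an extension with error ε can be corrected in the space of
random variables by a move of at most nε, then brought back with arbitrarily small error; iterating
gives a convergent sequence of embeddings (`exists_closer_embedding`). -/

open MeasureTheory Set Filter
open scoped Topology
open MetricStructure

/-! ### Random variables on the unit interval and optimal couplings -/

/-- Lebesgue measure on the unit interval, as a measure on the real line. -/
noncomputable abbrev unitMeasure : Measure ℝ := volume.restrict (Icc 0 1)

instance : IsProbabilityMeasure unitMeasure := ⟨by simp⟩

/-- A map from the line to a (finite) discrete set is a random variable if it is measurable for the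
discrete σ-algebra. -/
def IsRandomVariable {U : Type*} (X : ℝ → U) : Prop := @Measurable ℝ U _ ⊤ X

namespace IsRandomVariable

variable {U V : Type*} {X : ℝ → U} {Y : ℝ → V}

theorem measurableSet (hX : IsRandomVariable X) (p : U → Prop) : MeasurableSet {ω | p (X ω)} :=
  hX (t := {u | p u}) trivial

theorem of_fibers [Countable U] (h : ∀ u, MeasurableSet {ω | X ω = u}) : IsRandomVariable X :=
  @measurable_to_countable' U ℝ ⊤ _ _ X h

theorem const (u : U) : IsRandomVariable fun _ : ℝ => u :=
  @measurable_const U ℝ ⊤ _ u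

theorem comp (hX : IsRandomVariable X) (g : U → V) : IsRandomVariable fun ω => g (X ω) :=
  fun t _ => hX (t := g ⁻¹' t) trivial

theorem measurableSet_ne [Countable U] {X X' : ℝ → U} (hX : IsRandomVariable X)
    (hX' : IsRandomVariable X') : MeasurableSet {ω | X ω ≠ X' ω} := by
  have h : {ω | X ω ≠ X' ω} = ⋃ u, {ω | X ω = u} ∩ {ω | u ≠ X' ω} := by
    ext ω; simp
  rw [h]
  exact MeasurableSet.iUnion fun u =>
    (hX.measurableSet (· = u)).inter (hX'.measurableSet (u ≠ ·))

theorem pi {ι : Type*} [Finite ι] [Finite U] {X : ι → ℝ → U} (hX : ∀ i, IsRandomVariable (X i)) :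
    IsRandomVariable fun ω i => X i ω := by
  refine of_fibers fun s => ?_
  have h : {ω | (fun i => X i ω) = s} = ⋂ i, {ω | X i ω = s i} := by
    ext ω; simp [funext_iff]
  rw [h]
  exact MeasurableSet.iInter fun i => (hX i).measurableSet (· = s i)

theorem ite [Countable U] {X X' : ℝ → U} {E : Set ℝ} [DecidablePred (· ∈ E)] (hE : MeasurableSet E)
    (hX : IsRandomVariable X) (hX' : IsRandomVariable X') :
    IsRandomVariable fun ω => if ω ∈ E then X ω else X' ω :=
  by
  let _ : MeasurableSpace U := ⊤
  exact Measurable.ite (p := (· ∈ E)) hE hX hX'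

/-- The fibres of a random variable partition every set. -/
theorem sum_measure_inter [Fintype U] (hX : IsRandomVariable X) (A : Set ℝ) :
    ∑ u, unitMeasure.real (A ∩ {ω | X ω = u}) = unitMeasure.real A := by
  have h := sum_measureReal_preimage_singleton (μ := unitMeasure.restrict A)
    (Finset.univ : Finset U) (f := X) (fun u _ => hX.measurableSet (· = u))
  rw [Finset.coe_univ, preimage_univ, measureReal_restrict_apply MeasurableSet.univ,
    univ_inter] at h
  rw [← h]
  refine Finset.sum_congr rfl fun u _ => ?_
  rw [measureReal_restrict_apply (show MeasurableSet (X ⁻¹' {u}) from hX.measurableSet (· = u)),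
    inter_comm]
  rfl

theorem sum_measure [Fintype U] (hX : IsRandomVariable X) :
    ∑ u, unitMeasure.real {ω | X ω = u} = 1 := by
  simpa using hX.sum_measure_inter univ

end IsRandomVariable

/-- Absence of atoms: the mass of `A` to the left of `t` is a 1-Lipschitz function of `t` that
increases from 0 to the mass of `A`, so the intermediate value theorem applies. -/
theorem exists_subset_unitMeasure_eq {A : Set ℝ} (hA : MeasurableSet A) {r : ℝ} (h0 : 0 ≤ r)
    (hr : r ≤ unitMeasure.real A) :
    ∃ B ⊆ A, MeasurableSet B ∧ unitMeasure.real B = r := by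
  set g : ℝ → ℝ := fun t => unitMeasure.real (A ∩ Iic t) with hg
  have hmono : Monotone g := fun s t h =>
    measureReal_mono (inter_subset_inter_right _ (Iic_subset_Iic.2 h))
  have hlip : ∀ s t, s ≤ t → g t - g s ≤ t - s := by
    intro s t hst
    have h1 : g t ≤ g s + unitMeasure.real (Ioc s t) := by
      refine (measureReal_mono ?_).trans (measureReal_union_le _ _)
      rintro x ⟨hx, hxt⟩
      by_cases hxs : x ≤ s
      · exact Or.inl ⟨hx, hxs⟩
      · exact Or.inr ⟨not_le.1 hxs, hxt⟩
    have h2 : unitMeasure.real (Ioc s t) ≤ t - s := by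
      rw [measureReal_restrict_apply measurableSet_Ioc]
      refine (measureReal_mono inter_subset_left (by simp)).trans ?_
      simp [Real.volume_real_Ioc_of_le hst]
    linarith
  have hcont : Continuous g := by
    refine (LipschitzWith.of_dist_le_mul (K := 1) fun s t => ?_).continuous
    rw [NNReal.coe_one, one_mul, Real.dist_eq, Real.dist_eq]
    rcases le_total s t with h | h
    · rw [abs_sub_comm, abs_sub_comm s, abs_of_nonneg (sub_nonneg.2 (hmono h)),
        abs_of_nonneg (sub_nonneg.2 h)]
      exact hlip s t h
    · rw [abs_of_nonneg (sub_nonneg.2 (hmono h)), abs_of_nonneg (sub_nonneg.2 h)]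
      exact hlip t s h
  have hg0 : g 0 = 0 := by
    have h1 : g 0 ≤ unitMeasure.real (Iic 0) := measureReal_mono inter_subset_right
    have h2 : unitMeasure.real (Iic (0 : ℝ)) = 0 := by
      rw [measureReal_restrict_apply measurableSet_Iic]
      have : Iic (0 : ℝ) ∩ Icc 0 1 = {0} := by
        ext x
        simp only [mem_inter_iff, mem_Iic, mem_Icc, mem_singleton_iff]
        constructor
        · rintro ⟨h, h', -⟩; linarith
        · rintro rfl; norm_num
      rw [this]; simp [measureReal_def]
    exact le_antisymm (h1.trans h2.le) measureReal_nonneg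
  have hg1 : g 1 = unitMeasure.real A := by
    simp only [hg]
    rw [measureReal_restrict_apply (hA.inter measurableSet_Iic), measureReal_restrict_apply hA]
    congr 1
    ext x
    simp only [mem_inter_iff, mem_Iic, mem_Icc]
    tauto
  obtain ⟨t, -, ht⟩ := intermediate_value_Icc zero_le_one hcont.continuousOn
    (show r ∈ Icc (g 0) (g 1) by rw [hg0, hg1]; exact ⟨h0, hr⟩)
  exact ⟨A ∩ Iic t, inter_subset_left, hA.inter measurableSet_Iic, ht⟩

/-- One value at a time, a piece of the right mass is cut off from what is left of `A`. That `Z`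
stays in `s` even outside `A` is part of the induction: it prevents the remaining variable from
taking the newly added value. -/
theorem exists_randomVariable_of_masses {U : Type*} [Countable U] {s : Finset U} (hs : s.Nonempty)
    {r : U → ℝ} (hr : ∀ u, 0 ≤ r u) {A : Set ℝ} (hA : MeasurableSet A)
    (hsum : ∑ u ∈ s, r u = unitMeasure.real A) :
    ∃ Z : ℝ → U, IsRandomVariable Z ∧ (∀ ω, Z ω ∈ s) ∧
      ∀ u ∈ s, unitMeasure.real (A ∩ {ω | Z ω = u}) = r u := by
  classical
  induction hs using Finset.Nonempty.cons_induction generalizing A with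
  | singleton a =>
    refine ⟨fun _ => a, IsRandomVariable.const a, by simp, ?_⟩
    simpa using hsum.symm
  | cons a s ha hs ih =>
    rw [Finset.sum_cons] at hsum
    have hs0 : 0 ≤ ∑ u ∈ s, r u := Finset.sum_nonneg fun u _ => hr u
    obtain ⟨B, hBA, hB, hBr⟩ := exists_subset_unitMeasure_eq hA (hr a) (by linarith)
    obtain ⟨Z, hZ, hZs, hZr⟩ := ih (hA.diff hB) (by
      rw [measureReal_sdiff hBA hB]; linarith)
    refine ⟨fun ω => if ω ∈ B then a else Z ω,
      IsRandomVariable.ite hB (IsRandomVariable.const a) hZ, ?_, ?_⟩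
    · intro ω
      by_cases h : ω ∈ B
      · simp [h]
      · simp [h, hZs ω]
    · intro u hu
      rw [Finset.mem_cons] at hu
      rcases hu with rfl | hu
      · rw [← hBr]
        congr 1
        ext ω
        by_cases h : ω ∈ B
        · simp [h, hBA h]
        · simp only [mem_inter_iff, mem_ofPred_eq, h, if_false, iff_false, not_and]
          rintro - rfl
          exact ha (hZs ω)
      · rw [← hZr u hu]
        congr 1
        ext ω
        have hau : a ≠ u := fun h => ha (h ▸ hu)
        by_cases h : ω ∈ B <;> simp [h, hau]

/-- On an event `A`, a random variable `W` can be changed to one with prescribed masses `q` on `A`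
at the smallest possible cost. -/
theorem exists_coupling_on {U : Type*} [Fintype U] {W : ℝ → U} (hW : IsRandomVariable W)
    {q : U → ℝ} (hq : ∀ u, 0 ≤ q u) {A : Set ℝ} (hA : MeasurableSet A)
    (hsum : ∑ u, q u = unitMeasure.real A) :
    ∃ Z : ℝ → U, IsRandomVariable Z ∧ (∀ u, unitMeasure.real (A ∩ {ω | Z ω = u}) = q u) ∧
      unitMeasure.real (A ∩ {ω | W ω ≠ Z ω}) ≤
        ∑ u, max (unitMeasure.real (A ∩ {ω | W ω = u}) - q u) 0 := by
  classical
  have hAW : ∀ u, MeasurableSet (A ∩ {ω | W ω = u}) := fun u => hA.inter (hW.measurableSet (· = u))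
  -- `E u` is the part of {W = u} on which `W` is kept; its mass, the minimum of the old and the new
  -- mass of `u`, is the largest one possible.
  choose E hEA hE hEr using fun u => exists_subset_unitMeasure_eq (hAW u)
    (le_min measureReal_nonneg (hq u)) (min_le_left _ (q u))
  have hEE : MeasurableSet (⋃ u, E u) := MeasurableSet.iUnion hE
  have hmem : ∀ ω, ω ∈ (⋃ u, E u) ↔ ω ∈ E (W ω) := by
    intro ω
    rw [mem_iUnion]
    refine ⟨?_, fun h => ⟨_, h⟩⟩
    rintro ⟨u, hu⟩
    obtain rfl : W ω = u := (hEA u hu).2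
    exact hu
  have hEsub : (⋃ u, E u) ⊆ A := iUnion_subset fun u => (hEA u).trans inter_subset_left
  have hEm : unitMeasure.real (⋃ u, E u) =
      ∑ u, min (unitMeasure.real (A ∩ {ω | W ω = u})) (q u) := by
    rw [← hW.sum_measure_inter]
    refine Finset.sum_congr rfl fun u _ => ?_
    rw [← hEr u]
    congr 1
    ext ω
    simp only [mem_inter_iff, hmem, mem_ofPred_eq]
    refine ⟨fun h => h.2 ▸ h.1, fun h => ?_⟩
    have := (hEA u h).2
    simp only [mem_ofPred_eq] at this
    exact ⟨this ▸ h, this⟩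
  -- The rest of `A` supplies exactly the masses still missing. `W` changes only there, and the mass
  -- of this rest is the sum of the positive parts.
  obtain ⟨Z, hZ, -, hZr⟩ := exists_randomVariable_of_masses
    (s := (Finset.univ : Finset U)) ⟨W 0, Finset.mem_univ _⟩
    (r := fun u => q u - min (unitMeasure.real (A ∩ {ω | W ω = u})) (q u))
    (fun u => sub_nonneg.2 (min_le_right _ _)) (hA.diff hEE)
    (by rw [measureReal_sdiff hEsub hEE, Finset.sum_sub_distrib, hEm, hsum])
  refine ⟨fun ω => if ω ∈ ⋃ u, E u then W ω else Z ω, IsRandomVariable.ite hEE hW hZ, ?_, ?_⟩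
  · intro u
    have h : A ∩ {ω | (if ω ∈ ⋃ u, E u then W ω else Z ω) = u} =
        (A \ (⋃ u, E u)) ∩ {ω | Z ω = u} ∪ E u := by
      ext ω
      by_cases h : ω ∈ ⋃ u, E u
      · have hωA := hEsub h
        simp only [mem_inter_iff, mem_ofPred_eq, h, if_true, mem_union, Set.mem_sdiff, hωA, not_true,
          and_false, false_and, false_or, true_and]
        rw [hmem] at h
        exact ⟨fun h' => h' ▸ h, fun h' => (hEA u h').2⟩
      · have hu : ω ∉ E u := fun h' => h (mem_iUnion.2 ⟨u, h'⟩)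
        simp only [mem_inter_iff, mem_ofPred_eq, h, if_false, mem_union, Set.mem_sdiff, hu, or_false,
          not_false_eq_true, and_true]
    rw [h, measureReal_union _ (hE u), hZr u (Finset.mem_univ u), hEr u]
    · ring
    · refine Set.disjoint_left.2 fun ω hω hu => hω.1.2 (mem_iUnion.2 ⟨u, hu⟩)
  · have h : A ∩ {ω | W ω ≠ if ω ∈ ⋃ u, E u then W ω else Z ω} ⊆ A \ ⋃ u, E u := by
      rintro ω ⟨hωA, hω⟩
      refine ⟨hωA, fun h => ?_⟩
      simp only [mem_ofPred_eq, h, if_true, ne_eq, not_true] at hω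
    refine (measureReal_mono h).trans (le_of_eq ?_)
    rw [measureReal_sdiff hEsub hEE, hEm, ← hW.sum_measure_inter A, ← Finset.sum_sub_distrib]
    refine Finset.sum_congr rfl fun u _ => ?_
    rcases le_total (unitMeasure.real (A ∩ {ω | W ω = u})) (q u) with h | h
    · rw [min_eq_left h, max_eq_right (sub_nonpos.2 h), sub_self]
    · rw [min_eq_right h, max_eq_left (sub_nonneg.2 h)]

/-- Given random variables `A`, `W` and a joint distribution `q` with first marginal the
distribution of `A`, there is a random variable `Z` such that `(A, Z)` has distribution `q`, at the
smallest possible distance from `W`. -/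
theorem exists_coupling {T U : Type*} [Fintype T] [Fintype U] {A : ℝ → T} {W : ℝ → U}
    (hA : IsRandomVariable A) (hW : IsRandomVariable W) {q : T → U → ℝ} (hq : ∀ t u, 0 ≤ q t u)
    (hsum : ∀ t, ∑ u, q t u = unitMeasure.real {ω | A ω = t}) :
    ∃ Z : ℝ → U, IsRandomVariable Z ∧
      (∀ t u, unitMeasure.real {ω | A ω = t ∧ Z ω = u} = q t u) ∧
      unitMeasure.real {ω | W ω ≠ Z ω} ≤
        ∑ t, ∑ u, max (unitMeasure.real {ω | A ω = t ∧ W ω = u} - q t u) 0 := by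
  -- The fibres of `A` are treated separately, and the variable `Z t` is used on the fibre over `t`.
  choose Z hZ hZq hZW using fun t => exists_coupling_on hW (hq t) (hA.measurableSet (· = t)) (hsum t)
  refine ⟨fun ω => Z (A ω) ω, ?_, ?_, ?_⟩
  · refine IsRandomVariable.of_fibers fun u => ?_
    have h : {ω | Z (A ω) ω = u} = ⋃ t, {ω | A ω = t} ∩ {ω | Z t ω = u} := by
      ext ω; simp
    rw [h]
    exact MeasurableSet.iUnion fun t =>
      (hA.measurableSet (· = t)).inter ((hZ t).measurableSet (· = u))
  · intro t u
    rw [← hZq t u]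
    congr 1
    ext ω
    simp only [mem_ofPred_eq, mem_inter_iff]
    exact and_congr_right fun h => by rw [h]
  · rw [← hA.sum_measure_inter]
    refine Finset.sum_le_sum fun t _ => ?_
    refine le_trans (le_of_eq ?_) (hZW t)
    congr 1
    ext ω
    simp only [mem_ofPred_eq, mem_inter_iff]
    exact ⟨fun h => ⟨h.2, h.2 ▸ h.1⟩, fun h => ⟨h.1.symm ▸ h.2, h.1⟩⟩

/-! ### Substructures, tuple embeddings and joint laws -/

namespace MetricStructure

variable {L : ℕ → Type v}

/-- The substructure of `M` on a finite set of points. -/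
def restrict (M : MetricStructure.{u, v} L) (A : Set M) (hA : A.Finite) :
    MetricStructure.{u, v} L where
  carrier := A
  completeSpace := hA.isCompact.isComplete.completeSpace_coe
  interp R t := M.interp R (Subtype.val ∘ t)
  uniformContinuous_interp R := (M.uniformContinuous_interp R).comp
    (uniformContinuous_pi.2 fun i =>
      uniformContinuous_subtype_val.comp (Pi.uniformContinuous_proj _ i))

theorem IsTupleEmbedding.trans {M N P : MetricStructure.{u, v} L} {ι : Type*} {x : ι → M}
    {y : ι → N} {z : ι → P} (h : IsTupleEmbedding x y) (h' : IsTupleEmbedding y z) :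
    IsTupleEmbedding x z :=
  fun n P i => (h' n P i).trans (h n P i)

theorem IsTupleEmbedding.symm {M N : MetricStructure.{u, v} L} {ι : Type*} {x : ι → M}
    {y : ι → N} (h : IsTupleEmbedding x y) : IsTupleEmbedding y x :=
  fun n P i => (h n P i).symm

theorem IsTupleEmbedding.comp {M N : MetricStructure.{u, v} L} {ι κ : Type*} {x : ι → M}
    {y : ι → N} (h : IsTupleEmbedding x y) (i : κ → ι) : IsTupleEmbedding (x ∘ i) (y ∘ i) :=
  fun n P j => h n P (i ∘ j)

theorem IsTupleEmbedding.dist_eq {M N : MetricStructure.{u, v} L} {ι : Type*} {x : ι → M}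
    {y : ι → N} (h : IsTupleEmbedding x y) (i j : ι) : dist (y i) (y j) = dist (x i) (x j) := by
  simpa [eval] using h 2 .d ![i, j]

theorem IsEmbedding.isTupleEmbedding {M N : MetricStructure.{u, v} L} {φ : M → N}
    (h : IsEmbedding φ) {ι : Type*} (x : ι → M) : IsTupleEmbedding x (φ ∘ x) :=
  fun n P i => h n P (x ∘ i)

theorem IsEmbedding.isometry {M N : MetricStructure.{u, v} L} {φ : M → N} (h : IsEmbedding φ) :
    Isometry φ :=
  Isometry.of_dist_eq fun a b => (h.isTupleEmbedding id).dist_eq a b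

theorem IsEmbedding.comp {M N P : MetricStructure.{u, v} L} {φ : M → N} {ψ : N → P}
    (hψ : IsEmbedding ψ) (hφ : IsEmbedding φ) : IsEmbedding (ψ ∘ φ) :=
  fun n P t => (hψ n P (φ ∘ t)).trans (hφ n P t)

theorem IsTupleEmbedding.isEmbedding {M N : MetricStructure.{u, v} L} {φ : M → N}
    (h : IsTupleEmbedding id φ) : IsEmbedding φ :=
  fun n P t => h n P t

theorem isEmbedding_val (M : MetricStructure.{u, v} L) (A : Set M) (hA : A.Finite) :
    IsEmbedding (M := M.restrict A hA) (N := M) Subtype.val := by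
  intro n P t
  cases P <;> rfl

/-- A tuple of `M` with entries in `A`, as a tuple of the substructure on `A`. -/
theorem isTupleEmbedding_restrict (M : MetricStructure.{u, v} L) (A : Set M) (hA : A.Finite)
    {ι : Type*} (x : ι → M) (hx : ∀ i, x i ∈ A) :
    IsTupleEmbedding (N := M.restrict A hA) x (fun i => (⟨x i, hx i⟩ : A)) :=
  ((isEmbedding_val M A hA).isTupleEmbedding
    (fun i => ((⟨x i, hx i⟩ : A) : M.restrict A hA))).symm

/-- The embedding of a structure in the substructure on a set that contains its image. -/
theorem IsEmbedding.codRestrict {M N : MetricStructure.{u, v} L} {φ : M → N} (h : IsEmbedding φ)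
    (A : Set N) (hA : A.Finite) (hφ : ∀ a, φ a ∈ A) :
    IsEmbedding (N := N.restrict A hA) (fun a => (⟨φ a, hφ a⟩ : A)) :=
  ((h.isTupleEmbedding id).trans (isTupleEmbedding_restrict N A hA φ hφ)).isEmbedding

variable {S : Type v}

/-- The joint distribution of a finite family of points of a process. -/
noncomputable def law (T : MetricStructure.{u, v} (processLanguage S)) {ι : Type*} [Fintype ι]
    (t : ι → T) (s : ι → S) : ℝ :=
  T.fidi (t ∘ (Fintype.equivFin ι).symm) (s ∘ (Fintype.equivFin ι).symm)

theorem IsTupleEmbedding.fidi_eq {T U : MetricStructure.{u, v} (processLanguage S)} {ι : Type*}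
    {x : ι → T} {y : ι → U} (h : IsTupleEmbedding x y) {k : ℕ} (i : Fin k → ι) (s : Fin k → S) :
    U.fidi (y ∘ i) s = T.fidi (x ∘ i) s :=
  h k (.rel (show processLanguage S k from s)) i

theorem IsTupleEmbedding.law_eq {T U : MetricStructure.{u, v} (processLanguage S)} {ι : Type*}
    [Fintype ι] {x : ι → T} {y : ι → U} (h : IsTupleEmbedding x y) (s : ι → S) :
    U.law y s = T.law x s :=
  h.fidi_eq _ _

end MetricStructure

namespace IsNondegenerateProcess

variable {S : Type v} [Fintype S] {T U : MetricStructure.{u, v} (processLanguage S)}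
  {ι κ : Type*} [Fintype ι] [Fintype κ]

/-- This makes `law` independent of the enumeration chosen for the index type. -/
theorem fidi_comp_equiv (hT : IsNondegenerateProcess T) {k m : ℕ} (e : Fin k ≃ Fin m)
    (t : Fin m → T) (s : Fin m → S) : T.fidi (t ∘ e) (s ∘ e) = T.fidi t s := by
  obtain rfl : k = m := by simpa using Fintype.card_congr e
  exact hT.perm e t s

theorem law_fin (hT : IsNondegenerateProcess T) {k : ℕ} (t : Fin k → T) (s : Fin k → S) :
    T.law t s = T.fidi t s :=
  hT.fidi_comp_equiv _ t s

theorem law_nonneg (hT : IsNondegenerateProcess T) (t : ι → T) (s : ι → S) : 0 ≤ T.law t s :=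
  (hT.mem_Icc _ _).1

/-- The marginal axiom, which drops only the last entry, is iterated `m` times. -/
theorem fidi_castAdd (hT : IsNondegenerateProcess T) [DecidableEq S] {k m : ℕ}
    (t : Fin (k + m) → T) (s : Fin k → S) :
    T.fidi (t ∘ Fin.castAdd m) s =
      ∑ w : Fin (k + m) → S, if w ∘ Fin.castAdd m = s then T.fidi t w else 0 := by
  induction m with
  | zero =>
    change T.fidi t s = ∑ w : Fin k → S, if w = s then T.fidi t w else 0
    simp
  | succ m ih =>
    have h1 := ih (t ∘ Fin.castSucc)
    have h2 : (t ∘ Fin.castSucc) ∘ Fin.castAdd m = t ∘ Fin.castAdd (m + 1) := rfl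
    rw [h2] at h1
    refine h1.trans (Eq.trans ?_ ((Fin.snocEquiv fun _ : Fin (k + m + 1) => S).sum_comp
      fun w => if w ∘ Fin.castAdd (m + 1) = s then T.fidi t w else 0))
    rw [Fintype.sum_prod_type_right]
    refine Finset.sum_congr rfl fun w _ => ?_
    have h3 (z : S) : (Fin.snocEquiv fun _ : Fin (k + m + 1) => S) (z, w) ∘ Fin.castAdd (m + 1) =
        w ∘ Fin.castAdd m := by
      ext i
      exact Fin.snoc_castSucc (α := fun _ : Fin (k + m + 1) => S) z w (Fin.castAdd m i)
    simp only [h3]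
    split_ifs
    · rw [← hT.marginal (t ∘ Fin.castSucc) (t (Fin.last _)) w]
      refine Finset.sum_congr rfl fun z _ => ?_
      congr 1
      exact Fin.snoc_init_self t
    · simp

/-- An injection extends to a permutation, which reduces the claim to an initial segment. -/
theorem fidi_comp_injective (hT : IsNondegenerateProcess T) [DecidableEq S] {k n : ℕ}
    (t : Fin n → T) {i : Fin k → Fin n} (hi : Function.Injective i) (s : Fin k → S) :
    T.fidi (t ∘ i) s = ∑ w : Fin n → S, if w ∘ i = s then T.fidi t w else 0 := by
  obtain ⟨m, rfl⟩ := Nat.exists_eq_add_of_le (by simpa using Fintype.card_le_of_injective i hi)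
  obtain ⟨σ, hσ⟩ := Equiv.Perm.exists_extending_pair (Fin.castAdd m) i
    (Fin.castAdd_injective k m) hi
  have hσ' : i = σ ∘ Fin.castAdd m := funext fun a => (hσ a).symm
  have h := hT.fidi_castAdd (t ∘ σ) s
  rw [Function.comp_assoc, ← hσ'] at h
  refine h.trans (Fintype.sum_equiv (σ.arrowCongr (Equiv.refl S)) _ _ fun w => ?_)
  have h1 : (σ.arrowCongr (Equiv.refl S)) w ∘ i = w ∘ Fin.castAdd m := by
    ext a; simp [← hσ a]
  have h2 : (σ.arrowCongr (Equiv.refl S)) w ∘ σ = w := by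
    ext a; simp
  rw [h1, ← hT.perm σ t ((σ.arrowCongr (Equiv.refl S)) w), h2]

theorem law_comp_injective (hT : IsNondegenerateProcess T) [DecidableEq S] [DecidableEq ι]
    [DecidableEq κ] (t : ι → T) {i : κ → ι}
    (hi : Function.Injective i) (s : κ → S) :
    T.law (t ∘ i) s = ∑ w : ι → S, if w ∘ i = s then T.law t w else 0 := by
  set e := Fintype.equivFin ι
  set f := Fintype.equivFin κ
  have h := hT.fidi_comp_injective (t ∘ e.symm) (i := e ∘ i ∘ f.symm)
    (e.injective.comp (hi.comp f.symm.injective)) (s ∘ f.symm)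
  have h1 : (t ∘ e.symm) ∘ e ∘ i ∘ f.symm = (t ∘ i) ∘ f.symm := by
    ext; simp
  rw [h1] at h
  rw [law, h]
  refine (Fintype.sum_equiv (e.arrowCongr (Equiv.refl S)) _ _ fun w => ?_).symm
  have h2 : (e.arrowCongr (Equiv.refl S)) w ∘ e ∘ i ∘ f.symm = (w ∘ i) ∘ f.symm := by
    ext; simp
  have h3 : (e.arrowCongr (Equiv.refl S)) w = w ∘ e.symm := by
    ext; simp
  rw [h2, h3, law]
  simp only [f.symm.surjective.injective_comp_right.eq_iff]
  rfl

/-- As d(t a, t a) = 0, all the mass of the law of (t a, t a) is on the diagonal. The law of the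
whole family is dominated by its marginal at `a` and `b`. -/
theorem law_eq_zero (hT : IsNondegenerateProcess T) {t : ι → T} {s : ι → S} {a b : ι}
    (hab : t a = t b) (hs : s a ≠ s b) : T.law t s = 0 := by
  classical
  have hne : a ≠ b := fun h => hs (h ▸ rfl)
  have hinj : Function.Injective ![a, b] := by
    intro i j
    fin_cases i <;> fin_cases j <;> simp [hne, hne.symm]
  have h1 := hT.law_comp_injective t hinj (s ∘ ![a, b])
  have h2 : T.law t s ≤ T.law (t ∘ ![a, b]) (s ∘ ![a, b]) := by
    rw [h1]
    refine le_trans (by simp) (Finset.single_le_sum (f := fun w : ι → S =>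
      if w ∘ ![a, b] = s ∘ ![a, b] then T.law t w else 0) (fun w _ => ?_) (Finset.mem_univ s))
    split_ifs
    · exact hT.law_nonneg t w
    · exact le_rfl
  have h3 : T.fidi ![t a, t a] ![s a, s b] = 0 := by
    have hd := hT.dist_eq (t a) (t a)
    rw [dist_self, ← hT.sum_eq_one ![t a, t a], ← (finTwoArrowEquiv S).symm.sum_comp,
      Fintype.sum_prod_type, ← Finset.sum_sub_distrib] at hd
    have hz : ∀ x, 0 ≤ ∑ y, T.fidi ![t a, t a] ((finTwoArrowEquiv S).symm (x, y)) -
        T.fidi ![t a, t a] ![x, x] := fun x => sub_nonneg.2 <|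
      Finset.single_le_sum (f := fun y => T.fidi ![t a, t a] ((finTwoArrowEquiv S).symm (x, y)))
        (fun y _ => (hT.mem_Icc _ _).1) (Finset.mem_univ x)
    have h4 := (Finset.sum_eq_zero_iff_of_nonneg fun x _ => hz x).1 hd (s a) (Finset.mem_univ _)
    rw [show ![s a, s a] = (finTwoArrowEquiv S).symm (s a, s a) from rfl,
      ← Finset.sum_erase_eq_sub (f := fun y => T.fidi ![t a, t a]
      ((finTwoArrowEquiv S).symm (s a, y))) (Finset.mem_univ (s a))] at h4
    exact (Finset.sum_eq_zero_iff_of_nonneg fun x _ => (hT.mem_Icc _ _).1).1 h4 (s b)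
      (Finset.mem_erase.2 ⟨hs.symm, Finset.mem_univ _⟩)
  have h5 : t ∘ ![a, b] = ![t a, t a] := by
    ext i; fin_cases i <;> simp [hab]
  have h6 : s ∘ ![a, b] = ![s a, s b] := by
    ext i; fin_cases i <;> simp
  rw [h5, h6, hT.law_fin, h3] at h2
  exact le_antisymm h2 (hT.law_nonneg t s)

/-- The distribution of a subfamily, with repetitions allowed, is a marginal distribution. -/
theorem law_comp (hT : IsNondegenerateProcess T) [DecidableEq S] [DecidableEq ι]
    [DecidableEq κ] (t : ι → T) (i : κ → ι) (s : κ → S) :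
    T.law (t ∘ i) s = ∑ w : ι → S, if w ∘ i = s then T.law t w else 0 := by
  -- In this larger family both `t ∘ i` and `t` sit along injections, so the injective case applies
  -- to each. States that disagree on copies of the same point have probability 0 and drop out of
  -- the sum.
  set b : κ ⊕ ι → T := Sum.elim (t ∘ i) t with hb
  have h1 := hT.law_comp_injective b Sum.inl_injective s
  have h2 := fun w => hT.law_comp_injective b Sum.inr_injective w
  rw [hb, Sum.elim_comp_inl] at h1
  rw [hb, Sum.elim_comp_inr] at h2
  simp only [h1, h2]
  have h3 : ∀ w : ι → S, (if w ∘ i = s then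
      ∑ v : κ ⊕ ι → S, if v ∘ Sum.inr = w then T.law (Sum.elim (t ∘ i) t) v else 0 else 0) =
      ∑ v : κ ⊕ ι → S, if v ∘ Sum.inr = w then
        (if (v ∘ Sum.inr) ∘ i = s then T.law (Sum.elim (t ∘ i) t) v else 0) else 0 := by
    intro w
    split_ifs with h
    · refine Finset.sum_congr rfl fun v _ => ?_
      split_ifs with h4 h5
      · rfl
      · exact absurd (h4 ▸ h) h5
      · rfl
    · refine (Finset.sum_eq_zero fun v _ => ?_).symm
      split_ifs with h4 h5
      · exact absurd (h4 ▸ h5) h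
      · rfl
      · rfl
  simp only [h3]
  rw [Finset.sum_comm]
  refine Finset.sum_congr rfl fun v _ => ?_
  rw [Finset.sum_ite_eq Finset.univ (v ∘ Sum.inr)]
  simp only [Finset.mem_univ, if_true]
  by_cases hv : v ∘ Sum.inl = (v ∘ Sum.inr) ∘ i
  · rw [hv]
  · have : T.law (Sum.elim (t ∘ i) t) v = 0 := by
      obtain ⟨k, hk⟩ := Function.ne_iff.1 hv
      exact hT.law_eq_zero (a := Sum.inl k) (b := Sum.inr (i k)) rfl hk
    simp [this]

theorem sum_law (hT : IsNondegenerateProcess T) [DecidableEq ι] (t : ι → T) : ∑ s, T.law t s = 1 := by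
  rw [← hT.sum_eq_one (t ∘ (Fintype.equivFin ι).symm),
    ← ((Fintype.equivFin ι).symm.arrowCongr (Equiv.refl S)).sum_comp]
  refine Finset.sum_congr rfl fun s _ => ?_
  rw [law]
  congr 1
  ext; simp

theorem dist_eq_law (hT : IsNondegenerateProcess T) (t : Fin 2 → T) :
    dist (t 0) (t 1) = 1 - ∑ s : S, T.law t ![s, s] := by
  rw [← hT.dist_eq]
  have : ![t 0, t 1] = t := by ext i; fin_cases i <;> rfl
  simp only [this, hT.law_fin]

/-- The isomorphism type of a finite family of points is determined by its distribution. -/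
theorem isTupleEmbedding_iff (hT : IsNondegenerateProcess T) (hU : IsNondegenerateProcess U)
    {x : ι → T} {y : ι → U} : IsTupleEmbedding x y ↔ ∀ s, U.law y s = T.law x s := by
  classical
  refine ⟨fun h => h.law_eq, fun h => ?_⟩
  have h1 : ∀ {k : ℕ} (i : Fin k → ι) (s : Fin k → S), U.law (y ∘ i) s = T.law (x ∘ i) s := by
    intro k i s
    rw [hT.law_comp, hU.law_comp]
    simp only [h]
  intro n P i
  cases P with
  | rel R =>
    refine (hU.law_fin (y ∘ i) R).symm.trans ((h1 i R).trans (hT.law_fin (x ∘ i) R))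
  | d =>
    refine (hU.dist_eq_law (y ∘ i)).trans (Eq.trans ?_ (hT.dist_eq_law (x ∘ i)).symm)
    simp only [h1]

theorem of_isEmbedding (hU : IsNondegenerateProcess U) {φ : T → U} (hφ : IsEmbedding φ) :
    IsNondegenerateProcess T := by
  have h {k : ℕ} (t : Fin k → T) (s : Fin k → S) : T.fidi t s = U.fidi (φ ∘ t) s :=
    (hφ k (.rel (show processLanguage S k from s)) t).symm
  constructor
  · intro k t s
    rw [h]; exact hU.mem_Icc _ _
  · intro k t
    simp only [h]; exact hU.sum_eq_one _
  · intro k t t' s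
    simp only [h, Fin.comp_snoc]; exact hU.marginal _ _ _
  · intro k σ t s
    simp only [h]; exact hU.perm σ (φ ∘ t) s
  · intro t₁ t₂
    have h1 : φ ∘ ![t₁, t₂] = ![φ t₁, φ t₂] := by ext i; fin_cases i <;> rfl
    simp only [h, h1]
    rw [hU.dist_eq, hφ.isometry.dist_eq]

theorem restrict (hT : IsNondegenerateProcess T) (A : Set T) (hA : A.Finite) :
    IsNondegenerateProcess (T.restrict A hA) :=
  hT.of_isEmbedding (isEmbedding_val T A hA)

theorem restrict_mem (hT : IsNondegenerateProcess T) (A : Set T) (hA : A.Finite) :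
    T.restrict A hA ∈ finiteProcesses.{u, v} S :=
  ⟨hA.to_subtype, hT.restrict A hA⟩

theorem isStructure (hT : IsNondegenerateProcess T) :
    (finiteProcesses.{u, v} S).IsStructure T :=
  fun _ hA ⟨_, hφ⟩ => ⟨hA, hT.of_isEmbedding hφ⟩

end IsNondegenerateProcess

/-- Each axiom mentions only finitely many points, so it can be checked in the substructure on these
points. -/
theorem IsNondegenerateProcess.of_isStructure {S : Type v} [Fintype S]
    {T : MetricStructure.{u, v} (processLanguage S)}
    (hT : (finiteProcesses.{u, v} S).IsStructure T) : IsNondegenerateProcess T := by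
  have h (A : Set T) (hA : A.Finite) : IsNondegenerateProcess (T.restrict A hA) :=
    (hT _ hA.to_subtype ⟨_, isEmbedding_val T A hA⟩).2
  constructor
  · intro k t s
    exact (h _ (finite_range t)).mem_Icc (fun i => (⟨t i, i, rfl⟩ : range t)) s
  · intro k t
    exact (h _ (finite_range t)).sum_eq_one (fun i => (⟨t i, i, rfl⟩ : range t))
  · intro k t t' s
    have hA : (insert t' (range t)).Finite := (finite_range t).insert t'
    let x : Fin k → ↥(insert t' (range t)) := fun i => ⟨t i, Or.inr ⟨i, rfl⟩⟩
    let x' : ↥(insert t' (range t)) := ⟨t', Or.inl rfl⟩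
    have h1 : ∑ z, T.fidi (Subtype.val ∘ (Fin.snoc x x' : Fin (k + 1) → _)) (Fin.snoc s z) =
      T.fidi t s := (h _ hA).marginal x x' s
    rwa [Fin.comp_snoc] at h1
  · intro k σ t s
    exact (h _ (finite_range t)).perm σ (fun i => (⟨t i, i, rfl⟩ : range t)) s
  · intro t₁ t₂
    have hA : ({t₁, t₂} : Set T).Finite := by simp
    let x₁ : ({t₁, t₂} : Set T) := ⟨t₁, Or.inl rfl⟩
    let x₂ : ({t₁, t₂} : Set T) := ⟨t₂, Or.inr rfl⟩
    have h1 : 1 - ∑ s : S, T.fidi (Subtype.val ∘ ![x₁, x₂]) ![s, s] = dist t₁ t₂ :=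
      (h _ hA).dist_eq x₁ x₂
    have h2 : Subtype.val ∘ ![x₁, x₂] = ![t₁, t₂] := by
      ext i; fin_cases i <;> rfl
    rwa [h2] at h1

/-! ### The metric structure of all random variables -/

/-- The states of a process as points at mutual distance `1` in a normed space. -/
noncomputable def stateVector (S : Type v) [Fintype S] (s : S) : Fin (Fintype.card S) → ℝ :=
  Pi.single (Fintype.equivFin S s) 1

theorem dist_stateVector {S : Type v} [Fintype S] [DecidableEq S] (s s' : S) :
    dist (stateVector S s) (stateVector S s') = if s ≠ s' then 1 else 0 := by
  split_ifs with h
  · have h' : Fintype.equivFin S s ≠ Fintype.equivFin S s' := fun h' => h (by simpa using h')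
    refine le_antisymm ((dist_pi_le_iff zero_le_one).2 fun i => ?_) ?_
    · rw [stateVector, stateVector, Real.dist_eq]
      simp only [Pi.single_apply]
      split_ifs <;> norm_num
    · have := dist_le_pi_dist (stateVector S s) (stateVector S s') (Fintype.equivFin S s)
      refine le_trans (le_of_eq ?_) this
      simp [stateVector, h']
  · rw [not_not] at h
    rw [h, dist_self]

theorem stateVector_injective (S : Type v) [Fintype S] : Function.Injective (stateVector S) := by
  classical
  intro s s' h
  by_contra hne
  have := dist_stateVector s s'
  rw [h, dist_self, if_pos hne] at this
  exact zero_ne_one this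

/-- The classes, modulo almost sure equality, of `S`-valued random variables on the unit interval,
as functions with values in the state vectors. -/
def StateValued (S : Type v) [Fintype S] : Type :=
  {f : Lp (Fin (Fintype.card S) → ℝ) 1 unitMeasure //
    ∀ᵐ ω ∂unitMeasure, f ω ∈ range (stateVector S)}

namespace StateValued

variable {S : Type v} [Fintype S]

noncomputable instance : MetricSpace (StateValued S) :=
  inferInstanceAs (MetricSpace {f : Lp (Fin (Fintype.card S) → ℝ) 1 unitMeasure //
    ∀ᵐ ω ∂unitMeasure, f ω ∈ range (stateVector S)})

instance : SecondCountableTopology (StateValued S) := by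
  have : Fact ((1 : ENNReal) ≠ ⊤) := ⟨ENNReal.one_ne_top⟩
  exact inferInstanceAs (SecondCountableTopology
    {f : Lp (Fin (Fintype.card S) → ℝ) 1 unitMeasure //
      ∀ᵐ ω ∂unitMeasure, f ω ∈ range (stateVector S)})

/-- An L¹-convergent sequence has an almost surely convergent subsequence, and the finite set of
state vectors is closed; so the subset is closed in L¹. -/
instance : CompleteSpace (StateValued S) := by
  refine IsComplete.completeSpace_coe (IsClosed.isComplete ?_)
  refine isClosed_of_closure_subset fun g hg => ?_
  obtain ⟨f, hf, hfg⟩ := mem_closure_iff_seq_limit.1 hg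
  obtain ⟨n, -, hn⟩ := (tendstoInMeasure_of_tendsto_Lp hfg).exists_seq_tendsto_ae
  filter_upwards [ae_all_iff.2 hf, hn] with ω h1 h2
  exact (finite_range (stateVector S)).isClosed.mem_of_tendsto h2
    (Eventually.of_forall fun i => h1 (n i))

theorem exists_randomVariable (f : StateValued S) : ∃ X : ℝ → S, IsRandomVariable X ∧
    ∀ᵐ ω ∂unitMeasure, f.1 ω = stateVector S (X ω) := by
  classical
  -- The measure is not zero, so an almost sure property holds somewhere; this yields a default
  -- state for points outside the range of `stateVector`.
  obtain ⟨-, s₀, -⟩ := f.2.exists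
  have hm : Measurable (f.1 : ℝ → Fin (Fintype.card S) → ℝ) := (Lp.stronglyMeasurable f.1).measurable
  let g : (Fin (Fintype.card S) → ℝ) → S := Function.extend (stateVector S) id fun _ => s₀
  let _ : MeasurableSpace S := ⊤
  have : DiscreteMeasurableSpace S := ⟨fun _ => trivial⟩
  have hg : Measurable g :=
    ((measurable_from_top (f := stateVector S)).measurableEmbedding
      (stateVector_injective S)).measurable_extend measurable_id measurable_const
  refine ⟨g ∘ f.1, hg.comp hm, ?_⟩
  filter_upwards [f.2] with ω h
  obtain ⟨s, hs⟩ := h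
  rw [Function.comp_apply, ← hs]
  exact congrArg _ ((stateVector_injective S).extend_apply id _ s).symm

/-- A random variable in its class. -/
noncomputable def rv (f : StateValued S) : ℝ → S := f.exists_randomVariable.choose

theorem isRandomVariable_rv (f : StateValued S) : IsRandomVariable f.rv :=
  f.exists_randomVariable.choose_spec.1

theorem ae_eq_rv (f : StateValued S) : ∀ᵐ ω ∂unitMeasure, f.1 ω = stateVector S (f.rv ω) :=
  f.exists_randomVariable.choose_spec.2

/-- State vectors are at mutual distance 1, so the integrand of the L¹ distance is the indicator of
the event that the variables differ. -/
theorem dist_eq (f g : StateValued S) : dist f g = unitMeasure.real {ω | f.rv ω ≠ g.rv ω} := by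
  classical
  have h : dist f g = dist f.1 g.1 := rfl
  rw [h, L1.dist_eq_integral_dist, ← integral_indicator_one
    (f.isRandomVariable_rv.measurableSet_ne g.isRandomVariable_rv)]
  refine integral_congr_ae ?_
  filter_upwards [f.ae_eq_rv, g.ae_eq_rv] with ω hf hg
  rw [hf, hg, dist_stateVector]
  simp [indicator_apply]

theorem exists_of_randomVariable {X : ℝ → S} (hX : IsRandomVariable X) :
    ∃ f : StateValued S, ∀ᵐ ω ∂unitMeasure, f.rv ω = X ω := by
  have hm : AEStronglyMeasurable (fun ω => stateVector S (X ω)) unitMeasure := by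
    refine Measurable.aestronglyMeasurable ?_
    exact fun t ht => hX (t := stateVector S ⁻¹' t) trivial
  have hL : MemLp (fun ω => stateVector S (X ω)) 1 unitMeasure := by
    refine MemLp.of_bound hm 1 (Eventually.of_forall fun ω => ?_)
    rw [pi_norm_le_iff_of_nonneg zero_le_one]
    intro i
    simp only [stateVector, Pi.single_apply]
    split_ifs <;> norm_num
  let f : StateValued S := ⟨hL.toLp _, by
    filter_upwards [hL.coeFn_toLp] with ω h
    rw [h]; exact ⟨_, rfl⟩⟩
  refine ⟨f, ?_⟩
  filter_upwards [f.ae_eq_rv, hL.coeFn_toLp] with ω h h'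
  exact stateVector_injective S (h.symm.trans h')

end StateValued

theorem abs_unitMeasure_sub_le {A B D : Set ℝ} (hAB : A \ B ⊆ D) (hBA : B \ A ⊆ D) :
    |unitMeasure.real A - unitMeasure.real B| ≤ unitMeasure.real D := by
  have h (A B : Set ℝ) (h : A \ B ⊆ D) : unitMeasure.real A ≤ unitMeasure.real B +
      unitMeasure.real D := by
    refine (measureReal_mono fun x hx => ?_).trans (measureReal_union_le B D)
    by_cases hxB : x ∈ B
    · exact Or.inl hxB
    · exact Or.inr (h ⟨hx, hxB⟩)
  rw [abs_le]
  constructor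
  · linarith [h B A hBA]
  · linarith [h A B hAB]

theorem unitMeasure_exists_le {ι : Type*} [Fintype ι] (p : ι → ℝ → Prop) :
    unitMeasure.real {ω | ∃ i, p i ω} ≤ ∑ i, unitMeasure.real {ω | p i ω} := by
  have h : {ω | ∃ i, p i ω} = ⋃ i ∈ (Finset.univ : Finset ι), {ω | p i ω} := by
    ext; simp
  rw [h]
  exact measureReal_biUnion_finset_le _ _

/-- The two events can differ only where some coordinate does; the union bound gives the factor `k`.
This is the source of uniform continuity and of the constant `n` in `dInf_le`. -/
theorem StateValued.abs_law_sub_le {S : Type v} [Fintype S] {k : ℕ}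
    (t t' : Fin k → StateValued S) (s : Fin k → S) :
    |unitMeasure.real {ω | ∀ j, (t j).rv ω = s j} -
      unitMeasure.real {ω | ∀ j, (t' j).rv ω = s j}| ≤ k * dist t t' := by
  refine (abs_unitMeasure_sub_le (D := {ω | ∃ j, (t j).rv ω ≠ (t' j).rv ω}) ?_ ?_).trans ?_
  · rintro ω ⟨h1, h2⟩
    by_contra h
    simp only [mem_ofPred_eq, not_exists, ne_eq, not_not] at h
    exact h2 fun j => (h j) ▸ h1 j
  · rintro ω ⟨h1, h2⟩
    by_contra h
    simp only [mem_ofPred_eq, not_exists, ne_eq, not_not] at h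
    exact h2 fun j => (h j).trans (h1 j)
  · refine (unitMeasure_exists_le _).trans ?_
    simp only [← StateValued.dist_eq]
    refine (Finset.sum_le_card_nsmul _ _ (dist t t') fun j _ => ?_).trans (by simp)
    exact dist_le_pi_dist t t' j

/-- The process of all `S`-valued random variables on the unit interval, modulo almost sure
equality. -/
noncomputable def randomVariables (S : Type v) [Fintype S] : MetricStructure.{u, v} (processLanguage S) where
  carrier := ULift.{u} (StateValued S)
  completeSpace := ULift.instCompleteSpace
  interp {k} s t := unitMeasure.real {ω | ∀ j : Fin k, (t j).down.rv ω = s j}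
  uniformContinuous_interp {k} s := by
    refine (LipschitzWith.of_dist_le_mul (K := k) fun t t' => ?_).uniformContinuous
    rw [Real.dist_eq]
    exact StateValued.abs_law_sub_le (fun j => (t j).down) (fun j => (t' j).down) s

namespace randomVariables

variable {S : Type v} [Fintype S]

/-- A random variable in its class. -/
noncomputable def rv (f : randomVariables.{u, v} S) : ℝ → S := StateValued.rv f.down

theorem isRandomVariable_rv (f : randomVariables.{u, v} S) : IsRandomVariable (rv f) :=
  StateValued.isRandomVariable_rv f.down

theorem dist_eq (f g : randomVariables.{u, v} S) :
    dist f g = unitMeasure.real {ω | rv f ω ≠ rv g ω} :=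
  StateValued.dist_eq f.down g.down

theorem exists_ae_eq {X : ℝ → S} (hX : IsRandomVariable X) :
    ∃ f : randomVariables.{u, v} S, ∀ᵐ ω ∂unitMeasure, rv f ω = X ω :=
  let ⟨f, hf⟩ := StateValued.exists_of_randomVariable hX
  ⟨⟨f⟩, hf⟩

theorem fidi_eq {k : ℕ} (t : Fin k → randomVariables.{u, v} S) (s : Fin k → S) :
    (randomVariables.{u, v} S).fidi t s = unitMeasure.real {ω | ∀ j, rv (t j) ω = s j} := rfl

theorem law_eq {ι : Type*} [Fintype ι] (t : ι → randomVariables.{u, v} S) (s : ι → S) :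
    (randomVariables.{u, v} S).law t s = unitMeasure.real {ω | ∀ j, rv (t j) ω = s j} := by
  rw [law, fidi_eq]
  congr 1
  ext ω
  exact (Fintype.equivFin ι).symm.forall_congr_right (q := fun j => rv (t j) ω = s j)

instance : SecondCountableTopology (randomVariables.{u, v} S) :=
  (Homeomorph.ulift.{u, 0} (X := StateValued S)).secondCountableTopology

theorem isNondegenerateProcess : IsNondegenerateProcess (randomVariables.{u, v} S) := by
  classical
  constructor
  · intro k t s
    exact ⟨measureReal_nonneg, measureReal_le_one⟩
  · intro k t
    rw [← (IsRandomVariable.pi fun j => isRandomVariable_rv (t j)).sum_measure]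
    refine Finset.sum_congr rfl fun s _ => ?_
    rw [fidi_eq]
    simp only [funext_iff]
  · intro k t t' s
    rw [fidi_eq, ← (isRandomVariable_rv t').sum_measure_inter]
    refine Finset.sum_congr rfl fun z _ => ?_
    rw [fidi_eq]
    congr 1
    ext ω
    simp [Fin.forall_fin_succ']
  · intro k σ t s
    rw [fidi_eq, fidi_eq]
    congr 1
    ext ω
    exact σ.forall_congr_right (q := fun j => rv (t j) ω = s j)
  · intro f g
    have hm := (isRandomVariable_rv f).measurableSet_ne (isRandomVariable_rv g)
    have h : {ω | rv f ω ≠ rv g ω}ᶜ = {ω | rv f ω = rv g ω} := by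
      ext; simp
    rw [dist_eq, ← compl_compl {ω | rv f ω ≠ rv g ω}, probReal_compl_eq_one_sub hm.compl, h,
      ← (isRandomVariable_rv g).sum_measure_inter]
    congr 1
    refine Finset.sum_congr rfl fun s _ => ?_
    rw [fidi_eq]
    congr 1
    ext ω
    simp only [Fin.forall_fin_two, mem_ofPred_eq, mem_inter_iff]
    exact ⟨fun h => ⟨h.1.trans h.2.symm, h.2⟩, fun h => ⟨h.1.trans h.2, h.2⟩⟩

theorem abs_eval_sub_le {k : ℕ} (P : PredSymbol (processLanguage S) k)
    (t t' : Fin k → randomVariables.{u, v} S) :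
    |(randomVariables.{u, v} S).eval P t - (randomVariables.{u, v} S).eval P t'| ≤
      k * dist t t' := by
  cases P with
  | rel R =>
    exact StateValued.abs_law_sub_le (fun j => (t j).down) (fun j => (t' j).down) R
  | d =>
    have h0 := dist_le_pi_dist t t' 0
    have h1 := dist_le_pi_dist t t' 1
    have h := dist_dist_dist_le (t 0) (t 1) (t' 0) (t' 1)
    rw [Real.dist_eq] at h
    refine h.trans ?_
    push_cast
    linarith

end randomVariables

/-! ### Couplings as embeddings and the exact extension property -/

theorem IsNondegenerateProcess.law_comp_equiv {S : Type v} [Fintype S]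
    {T : MetricStructure.{u, v} (processLanguage S)} (hT : IsNondegenerateProcess T)
    {ι κ : Type*} [Fintype ι] [Fintype κ] (e : κ ≃ ι) (t : ι → T) (s : κ → S) :
    T.law (t ∘ e) s = T.law t (s ∘ e.symm) := by
  have h := hT.fidi_comp_equiv ((Fintype.equivFin κ).symm.trans (e.trans (Fintype.equivFin ι)))
    (t ∘ (Fintype.equivFin ι).symm) ((s ∘ e.symm) ∘ (Fintype.equivFin ι).symm)
  rw [law, law, ← h]
  congr 1 <;> ext <;> simp

/-- The single nullary probability is forced to be 1. Hence extension can start from the empty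
tuple. -/
theorem IsNondegenerateProcess.isTupleEmbedding_of_isEmpty {S : Type v} [Fintype S]
    {T U : MetricStructure.{u, v} (processLanguage S)} (hT : IsNondegenerateProcess T)
    (hU : IsNondegenerateProcess U) {ι : Type*} [IsEmpty ι] (x : ι → T) (y : ι → U) :
    IsTupleEmbedding x y := by
  classical
  have : Fintype ι := Fintype.ofIsEmpty
  refine (hT.isTupleEmbedding_iff hU).2 fun s => ?_
  have h1 := hT.sum_law x
  have h2 := hU.sum_law y
  rw [Fintype.sum_unique] at h1 h2
  rw [Subsingleton.elim s default, h1, h2]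

theorem IsNondegenerateProcess.dist_le_one {S : Type v} [Fintype S]
    {T : MetricStructure.{u, v} (processLanguage S)} (hT : IsNondegenerateProcess T) (a b : T) :
    dist a b ≤ 1 := by
  rw [← hT.dist_eq]
  linarith [Finset.sum_nonneg fun (s : S) (_ : s ∈ Finset.univ) =>
    (hT.mem_Icc ![a, b] ![s, s]).1]

/-- The positive part of the difference of two distributions has half of the mass of the
difference. -/
theorem sum_max_sub_le {α : Type*} [Fintype α] {p q : α → ℝ} (h : ∑ x, p x = ∑ x, q x) {δ : ℝ}
    (hδ : ∀ x, |p x - q x| ≤ δ) :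
    ∑ x, max (p x - q x) 0 ≤ 1 / 2 * Fintype.card α * δ := by
  have h1 : ∑ x, max (p x - q x) 0 = ∑ x, 1 / 2 * |p x - q x| := by
    have h2 : ∀ x, max (p x - q x) 0 = 1 / 2 * |p x - q x| + 1 / 2 * (p x - q x) := by
      intro x
      rcases le_total (p x - q x) 0 with h | h
      · rw [max_eq_right h, abs_of_nonpos h]; ring
      · rw [max_eq_left h, abs_of_nonneg h]; ring
    simp only [h2, Finset.sum_add_distrib, ← Finset.mul_sum, Finset.sum_sub_distrib, h]
    ring
  rw [h1]
  calc ∑ x, 1 / 2 * |p x - q x| ≤ ∑ _x : α, 1 / 2 * δ :=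
        Finset.sum_le_sum fun x _ => by linarith [hδ x]
    _ = 1 / 2 * Fintype.card α * δ := by simp; ring

namespace randomVariables

variable {S : Type v} [Fintype S] {B : MetricStructure.{u, v} (processLanguage S)}
  {ι κ : Type*} [Fintype ι] [Fintype κ] [DecidableEq ι] [DecidableEq κ]

/-- Realisation of a joint distribution next to given random variables `w`. -/
theorem exists_coupling (hB : IsNondegenerateProcess B) {x : ι → randomVariables.{u, v} S}
    (w : κ → randomVariables.{u, v} S) {t : ι → B} (u : κ → B) (h : IsTupleEmbedding t x) :
    ∃ z : κ → randomVariables.{u, v} S, IsTupleEmbedding (Sum.elim t u) (Sum.elim x z) ∧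
      unitMeasure.real {ω | ∃ j, rv (w j) ω ≠ rv (z j) ω} ≤
        ∑ v, max ((randomVariables.{u, v} S).law (Sum.elim x w) v - B.law (Sum.elim t u) v) 0 := by
  classical
  have hM : IsNondegenerateProcess (randomVariables.{u, v} S) := isNondegenerateProcess
  -- Compatibility of marginals: the prescribed law restricts to that of `t`, which is the law of
  -- `x` by `h`.
  have hsum : ∀ s : ι → S, ∑ r : κ → S, B.law (Sum.elim t u) (Sum.elim s r) =
      unitMeasure.real {ω | (fun i => rv (x i) ω) = s} := by
    intro s
    have h1 : unitMeasure.real {ω | (fun i => rv (x i) ω) = s} = B.law t s := by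
      rw [← h.law_eq, law_eq]
      simp only [funext_iff]
    have h2 := hB.law_comp (Sum.elim t u) Sum.inl s
    rw [Sum.elim_comp_inl, ← (Equiv.sumArrowEquivProdArrow ι κ S).symm.sum_comp,
      Fintype.sum_prod_type] at h2
    have h3 (a : ι → S) (b : κ → S) :
      (Equiv.sumArrowEquivProdArrow ι κ S).symm (a, b) = Sum.elim a b := rfl
    simp only [h3, Sum.elim_comp_inl] at h2
    rw [h1, h2, Finset.sum_comm]
    simp
  obtain ⟨Z, hZ, hZq, hZW⟩ := _root_.exists_coupling
    (IsRandomVariable.pi fun i => isRandomVariable_rv (x i))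
    (IsRandomVariable.pi fun j => isRandomVariable_rv (w j))
    (q := fun s r => B.law (Sum.elim t u) (Sum.elim s r)) (fun s r => hB.law_nonneg _ _) hsum
  -- The whole family was coupled as one variable with values in S^κ; its coordinates are the points
  -- sought.
  choose z hz using fun j => exists_ae_eq.{u, v} (hZ.comp fun r => r j)
  have hz' : ∀ᵐ ω ∂unitMeasure, ∀ j, rv (z j) ω = Z ω j := ae_all_iff.2 hz
  refine ⟨z, (hB.isTupleEmbedding_iff hM).2 fun v => ?_, ?_⟩
  · have h1 : Sum.elim (v ∘ Sum.inl) (v ∘ Sum.inr) = v := Sum.elim_comp_inl_inr v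
    rw [← h1, ← hZq, law_eq]
    refine measureReal_congr ?_
    filter_upwards [hz'] with ω hω
    refine propext ?_
    change (∀ j, rv (Sum.elim x z j) ω = _) ↔ (_ ∧ _)
    simp [funext_iff, hω]
  · have h1 : unitMeasure.real {ω | ∃ j, rv (w j) ω ≠ rv (z j) ω} =
        unitMeasure.real {ω | (fun j => rv (w j) ω) ≠ Z ω} := by
      refine measureReal_congr ?_
      filter_upwards [hz'] with ω hω
      refine propext ?_
      change (∃ j, rv (w j) ω ≠ rv (z j) ω) ↔ (fun j => rv (w j) ω) ≠ Z ω
      simp only [hω]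
      rw [Function.ne_iff]
    rw [h1]
    refine hZW.trans (le_of_eq ?_)
    rw [← (Equiv.sumArrowEquivProdArrow ι κ S).symm.sum_comp, Fintype.sum_prod_type]
    refine Finset.sum_congr rfl fun s _ => Finset.sum_congr rfl fun r _ => ?_
    have h3 : (Equiv.sumArrowEquivProdArrow ι κ S).symm (s, r) = Sum.elim s r := rfl
    rw [h3, law_eq]
    congr 4
    ext ω
    simp [funext_iff]

theorem dist_le_measure_exists_ne {κ : Type*} (w z : κ → randomVariables.{u, v} S) (j : κ) :
    dist (w j) (z j) ≤ unitMeasure.real {ω | ∃ j, rv (w j) ω ≠ rv (z j) ω} := by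
  rw [dist_eq]
  exact measureReal_mono fun ω hω => ⟨j, hω⟩

theorem exists_extension (hB : IsNondegenerateProcess B) {x : ι → randomVariables.{u, v} S}
    {t : ι → B} (u : κ → B) (h : IsTupleEmbedding t x) :
    ∃ z : κ → randomVariables.{u, v} S, IsTupleEmbedding (Sum.elim t u) (Sum.elim x z) := by
  -- The coupling needs some reference family, no matter which. If `κ` has a point, then `S` is
  -- nonempty, since an empty sum of probabilities cannot be 1.
  have hw : Nonempty (κ → randomVariables.{u, v} S) := by
    rcases isEmpty_or_nonempty κ with hκ | ⟨⟨j⟩⟩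
    · infer_instance
    · have h1 := hB.sum_eq_one ![u j]
      have hS : Nonempty S := by
        by_contra hS
        rw [not_nonempty_iff] at hS
        simp at h1
      obtain ⟨f, -⟩ := exists_ae_eq.{u, v} (IsRandomVariable.const hS.some)
      exact ⟨fun _ => f⟩
  obtain ⟨z, hz, -⟩ := exists_coupling hB hw.some u h
  exact ⟨z, hz⟩

/-- The extension property of the process of all random variables. -/
theorem exists_embedding (hB : B ∈ finiteProcesses.{u, v} S) {x : ι → randomVariables.{u, v} S}
    {t : ι → B} (h : IsTupleEmbedding t x) :
    ∃ f : B → randomVariables.{u, v} S, IsEmbedding f ∧ ∀ i, f (t i) = x i := by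
  classical
  have := hB.1
  have := Fintype.ofFinite B
  obtain ⟨z, hz⟩ := exists_extension hB.2 id h
  refine ⟨z, (hz.comp Sum.inr).isEmbedding, fun i => ?_⟩
  -- The point `t i` occurs twice, realised by `z (t i)` and by `x i`; distance 0 forces these to
  -- coincide.
  have h1 := hz.dist_eq (Sum.inr (t i)) (Sum.inl i)
  simpa using h1

theorem exists_embedding_of_mem (hB : B ∈ finiteProcesses.{u, v} S) :
    ∃ f : B → randomVariables.{u, v} S, IsEmbedding f := by
  have h0 : IsTupleEmbedding (Fin.elim0 : Fin 0 → B)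
      (Fin.elim0 : Fin 0 → randomVariables.{u, v} S) :=
    hB.2.isTupleEmbedding_of_isEmpty isNondegenerateProcess _ _
  obtain ⟨f, hf, -⟩ := exists_embedding hB h0
  exact ⟨f, hf⟩

theorem exists_tuple {n : ℕ} (a : (finiteProcesses.{u, v} S).Enumerated n) :
    ∃ x : Fin n → randomVariables.{u, v} S, IsTupleEmbedding a.tuple x :=
  let ⟨f, hf⟩ := exists_embedding_of_mem a.mem
  ⟨f ∘ a.tuple, hf.isTupleEmbedding a.tuple⟩

/-- The enumerated structure of a tuple of random variables. -/
noncomputable def enumerated {n : ℕ} (x : Fin n → randomVariables.{u, v} S) :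
    (finiteProcesses.{u, v} S).Enumerated n where
  str := (randomVariables.{u, v} S).restrict (range x) (finite_range x)
  mem := isNondegenerateProcess.restrict_mem _ _
  tuple i := (⟨x i, i, rfl⟩ : range x)

theorem isTupleEmbedding_enumerated {n : ℕ} (x : Fin n → randomVariables.{u, v} S) :
    IsTupleEmbedding (enumerated x).tuple x :=
  (isTupleEmbedding_restrict _ _ (finite_range x) x fun i => ⟨i, rfl⟩).symm

end randomVariables

/-! ### The Fraïssé properties of the class -/

namespace finiteProcesses

open randomVariables

variable (S : Type v) [Fintype S]

theorem hp : (finiteProcesses.{u, v} S).HP :=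
  fun _ hA => hA.2.isStructure

theorem jep : (finiteProcesses.{u, v} S).JEP := by
  intro A hA B hB
  obtain ⟨f, hf⟩ := exists_embedding_of_mem hA
  obtain ⟨g, hg⟩ := exists_embedding_of_mem hB
  have := hA.1
  have := hB.1
  have h : (range f ∪ range g).Finite := (finite_range f).union (finite_range g)
  exact ⟨_, isNondegenerateProcess.restrict_mem _ h,
    ⟨_, hf.codRestrict _ h fun a => Or.inl ⟨a, rfl⟩⟩,
    ⟨_, hg.codRestrict _ h fun b => Or.inr ⟨b, rfl⟩⟩⟩

theorem ap : (finiteProcesses.{u, v} S).AP := by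
  classical
  intro A hA B hB C hC fB fC hfB hfC
  have := hA.1
  have := hB.1
  have := hC.1
  have := Fintype.ofFinite A
  obtain ⟨g, hg⟩ := exists_embedding_of_mem hB
  obtain ⟨f, hf, hfg⟩ := exists_embedding hC (x := g ∘ fB) (t := fC)
    ((hfC.isTupleEmbedding id).symm.trans ((hg.comp hfB).isTupleEmbedding id))
  have h : (range g ∪ range f).Finite := (finite_range g).union (finite_range f)
  refine ⟨_, isNondegenerateProcess.restrict_mem _ h, _, _,
    hg.codRestrict _ h fun a => Or.inl ⟨a, rfl⟩, hf.codRestrict _ h fun b => Or.inr ⟨b, rfl⟩, ?_⟩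
  exact funext fun a => Subtype.ext (hfg a).symm

variable {S} {n : ℕ}

theorem bddAbove_fidiDist (a b : (finiteProcesses.{u, v} S).Enumerated n) :
    BddAbove {r : ℝ | ∃ (m : ℕ) (A : Fin m ↪o Fin n) (s : Fin m → S),
      r = |a.str.fidi (a.tuple ∘ A) s - b.str.fidi (b.tuple ∘ A) s|} := by
  refine ⟨1, ?_⟩
  rintro _ ⟨m, A, s, rfl⟩
  obtain ⟨h1, h2⟩ := a.mem.2.mem_Icc (a.tuple ∘ A) s
  obtain ⟨h3, h4⟩ := b.mem.2.mem_Icc (b.tuple ∘ A) s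
  rw [abs_le]
  constructor <;> linarith

theorem bddAbove_dInf (a b : (finiteProcesses.{u, v} S).Enumerated n) :
    BddAbove {r : ℝ | ∃ (m : ℕ) (X : Fin m ↪o Fin n) (P : PredSymbol (processLanguage S) m),
      r = |a.str.eval P (a.tuple ∘ X) - b.str.eval P (b.tuple ∘ X)|} := by
  refine ⟨1, ?_⟩
  have h {T : MetricStructure.{u, v} (processLanguage S)} (hT : IsNondegenerateProcess T) {m : ℕ}
      (P : PredSymbol (processLanguage S) m) (t : Fin m → T) :
      0 ≤ T.eval P t ∧ T.eval P t ≤ 1 := by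
    cases P with
    | rel R => exact hT.mem_Icc t R
    | d => exact ⟨dist_nonneg, hT.dist_le_one _ _⟩
  rintro _ ⟨m, X, P, rfl⟩
  obtain ⟨h1, h2⟩ := h a.mem.2 P (a.tuple ∘ X)
  obtain ⟨h3, h4⟩ := h b.mem.2 P (b.tuple ∘ X)
  rw [abs_le]
  constructor <;> linarith

theorem abs_fidi_sub_le (a b : (finiteProcesses.{u, v} S).Enumerated n) (s : Fin n → S) :
    |a.str.fidi a.tuple s - b.str.fidi b.tuple s| ≤ fidiDist a b :=
  le_csSup (bddAbove_fidiDist a b) ⟨n, RelEmbedding.refl _, s, rfl⟩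

theorem fidiDist_nonneg (a b : (finiteProcesses.{u, v} S).Enumerated n) : 0 ≤ fidiDist a b :=
  (abs_nonneg _).trans (le_csSup (bddAbove_fidiDist a b)
    ⟨0, Fin.castLEOrderEmb (Nat.zero_le n), Fin.elim0, rfl⟩)

theorem abs_eval_sub_le_dInf (a b : (finiteProcesses.{u, v} S).Enumerated n)
    (P : PredSymbol (processLanguage S) n) :
    |a.str.eval P a.tuple - b.str.eval P b.tuple| ≤ StructureClass.dInf a b :=
  le_csSup (bddAbove_dInf a b) ⟨n, RelEmbedding.refl _, P, rfl⟩

theorem fidiDist_le_dInf (a b : (finiteProcesses.{u, v} S).Enumerated n) :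
    fidiDist a b ≤ StructureClass.dInf a b := by
  refine csSup_le ⟨_, 0, Fin.castLEOrderEmb (Nat.zero_le n), Fin.elim0, rfl⟩ ?_
  rintro _ ⟨m, A, s, rfl⟩
  exact le_csSup (bddAbove_dInf a b) ⟨m, A, .rel (show processLanguage S m from s), rfl⟩

/-- The entries of `b` indexed by `κ` are coupled optimally with those of `a`, the others being
shared. The cost is half the ℓ¹ distance of two laws on the |S|ⁿ points of Sⁿ. A one-point `κ` gives
bounded amalgamation, an empty `ι` the upper bound on d_K. -/
theorem exists_near {ι κ : Type*} [Fintype ι] [Fintype κ]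
    (a b : (finiteProcesses.{u, v} S).Enumerated n)
    (e : ι ⊕ κ ≃ Fin n) {x : Fin n → randomVariables.{u, v} S} (hx : IsTupleEmbedding a.tuple x)
    (h : IsTupleEmbedding (a.tuple ∘ e ∘ Sum.inl) (b.tuple ∘ e ∘ Sum.inl)) :
    ∃ z : Fin n → randomVariables.{u, v} S, IsTupleEmbedding b.tuple z ∧
      (∀ i, z (e (Sum.inl i)) = x (e (Sum.inl i))) ∧
      ∀ k, dist (x k) (z k) ≤ 1 / 2 * (Fintype.card S : ℝ) ^ n * fidiDist a b := by
  classical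
  obtain ⟨z, hz, hd⟩ := exists_coupling b.mem.2 (x ∘ e ∘ Sum.inr) (b.tuple ∘ e ∘ Sum.inr)
    (h.symm.trans (hx.comp (e ∘ Sum.inl)))
  have h1 {α : Type u} (t : Fin n → α) :
      Sum.elim (t ∘ e ∘ Sum.inl) (t ∘ e ∘ Sum.inr) = t ∘ e := Sum.elim_comp_inl_inr (t ∘ e)
  rw [h1] at hz
  have hM : IsNondegenerateProcess (randomVariables.{u, v} S) := isNondegenerateProcess
  have h2 : ∀ j, dist (x (e (Sum.inr j))) (z j) ≤
      1 / 2 * (Fintype.card S : ℝ) ^ n * fidiDist a b := by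
    intro j
    refine (dist_le_measure_exists_ne (x ∘ e ∘ Sum.inr) z j).trans (hd.trans ?_)
    rw [h1, h1]
    refine (sum_max_sub_le ?_ (δ := fidiDist a b) fun v => ?_).trans (le_of_eq ?_)
    · rw [hM.sum_law, b.mem.2.sum_law]
    · rw [hM.law_comp_equiv, b.mem.2.law_comp_equiv, hx.law_eq, a.mem.2.law_fin, b.mem.2.law_fin]
      exact abs_fidi_sub_le a b _
    · rw [Fintype.card_fun, Fintype.card_congr e, Fintype.card_fin]
      push_cast
      rfl
  refine ⟨Sum.elim (x ∘ e ∘ Sum.inl) z ∘ e.symm, ?_, fun i => by simp, fun k => ?_⟩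
  · have := hz.comp e.symm
    rwa [Function.comp_assoc, Equiv.self_comp_symm, Function.comp_id] at this
  · obtain ⟨i | j, rfl⟩ := e.surjective k
    · simp only [Function.comp_apply, Equiv.symm_apply_apply, Sum.elim_inl, dist_self]
      have := fidiDist_nonneg a b
      positivity
    · simpa using h2 j

theorem boundedAmalgamation (S : Type v) [Fintype S] (n : ℕ) :
    (finiteProcesses.{u, v} S).BoundedAmalgamation n
      (fun x y => 1 / 2 * (Fintype.card S : ℝ) ^ (n + 1) * fidiDist x y) := by
  intro a b hab
  obtain ⟨x, hx⟩ := exists_tuple a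
  let e : Fin n ⊕ Fin 1 ≃ Fin (n + 1) := finSumFinEquiv
  obtain ⟨z, hz, hzx, hd⟩ := exists_near a b e hx hab
  have h : (range x ∪ range z).Finite := (finite_range x).union (finite_range z)
  let D := (randomVariables.{u, v} S).restrict _ h
  let x' : Fin (n + 1) → D := fun i => (⟨x i, Or.inl ⟨i, rfl⟩⟩ : ↥(range x ∪ range z))
  let z' : Fin (n + 1) → D := fun i => (⟨z i, Or.inr ⟨i, rfl⟩⟩ : ↥(range x ∪ range z))
  have hx' : IsTupleEmbedding a.tuple x' := hx.trans (isTupleEmbedding_restrict _ _ h x _)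
  have hz' : IsTupleEmbedding b.tuple z' := hz.trans (isTupleEmbedding_restrict _ _ h z _)
  have hsnoc (y : Fin (n + 1) → D) :
      (Fin.snoc (fun i => y i.castSucc) (y (Fin.last n)) : Fin (n + 1) → D) = y :=
    Fin.snoc_init_self y
  have hxz : (fun i : Fin n => x' i.castSucc) = fun i => z' i.castSucc :=
    funext fun i => Subtype.ext (hzx i).symm
  refine ⟨D, isNondegenerateProcess.restrict_mem _ h, fun i => x' i.castSucc, x' (Fin.last n),
    z' (Fin.last n), ?_, ?_, hd (Fin.last n)⟩
  · rwa [hsnoc]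
  · rwa [hxz, hsnoc]

theorem bap (S : Type v) [Fintype S] : (finiteProcesses.{u, v} S).BAP := by
  refine fun n => ⟨1 / 2 * (Fintype.card S : ℝ) ^ (n + 1), fun a b hab => ?_⟩
  obtain ⟨B, hB, t, w, z, hw, hz, hd⟩ := boundedAmalgamation S n a b hab
  exact ⟨B, hB, t, w, z, hw, hz, hd.trans
    (mul_le_mul_of_nonneg_left (fidiDist_le_dInf a b) (by positivity))⟩

theorem dK_le_dist {a b : (finiteProcesses.{u, v} S).Enumerated n}
    {x y : Fin n → randomVariables.{u, v} S} (hx : IsTupleEmbedding a.tuple x)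
    (hy : IsTupleEmbedding b.tuple y) : (finiteProcesses.{u, v} S).dK a b ≤ dist x y := by
  have h : (range x ∪ range y).Finite := (finite_range x).union (finite_range y)
  refine csInf_le ⟨0, ?_⟩ ⟨(randomVariables.{u, v} S).restrict _ h,
    isNondegenerateProcess.restrict_mem _ h, _, _,
    hx.trans (isTupleEmbedding_restrict _ _ h x fun i => Or.inl ⟨i, rfl⟩),
    hy.trans (isTupleEmbedding_restrict _ _ h y fun i => Or.inr ⟨i, rfl⟩), rfl⟩
  rintro _ ⟨C, -, a', b', -, -, rfl⟩
  exact dist_nonneg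

/-- A nearly optimal joint embedding can be moved, by exact extension, so that the copy of `a` lands
on the given `x`. This lets one chain near-optimal embeddings. -/
theorem exists_dist_lt {a b : (finiteProcesses.{u, v} S).Enumerated n}
    {x : Fin n → randomVariables.{u, v} S} (hx : IsTupleEmbedding a.tuple x) {r : ℝ}
    (hr : (finiteProcesses.{u, v} S).dK a b < r) :
    ∃ y : Fin n → randomVariables.{u, v} S, IsTupleEmbedding b.tuple y ∧ dist x y < r := by
  obtain ⟨C₀, hC₀, ⟨f, hf⟩, ⟨g, hg⟩⟩ := jep S a.str a.mem b.str b.mem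
  have hne : {r : ℝ | ∃ C ∈ finiteProcesses.{u, v} S, ∃ a' b' : Fin n → C,
      IsTupleEmbedding a.tuple a' ∧ IsTupleEmbedding b.tuple b' ∧ r = dist a' b'}.Nonempty :=
    ⟨_, C₀, hC₀, _, _, hf.isTupleEmbedding a.tuple, hg.isTupleEmbedding b.tuple, rfl⟩
  obtain ⟨_, ⟨C, hC, a', b', ha, hb, rfl⟩, hlt⟩ := exists_lt_of_csInf_lt hne hr
  obtain ⟨f, hf, hfx⟩ := exists_embedding hC (ha.symm.trans hx)
  refine ⟨f ∘ b', hb.trans (hf.isTupleEmbedding b'), lt_of_le_of_lt (le_of_eq ?_) hlt⟩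
  obtain rfl : f ∘ a' = x := funext hfx
  simp only [dist_pi_def, Function.comp_apply, hf.isometry.nndist_eq]

theorem dInf_le (a b : (finiteProcesses.{u, v} S).Enumerated n) :
    StructureClass.dInf a b ≤ n * (finiteProcesses.{u, v} S).dK a b := by
  obtain ⟨x, hx⟩ := exists_tuple a
  -- Whether the infimum is attained is left open: the bound is proved above it, then `r` tends to
  -- d_K.
  have h : ∀ r, (finiteProcesses.{u, v} S).dK a b < r → StructureClass.dInf a b ≤ n * r := by
    intro r hr
    obtain ⟨y, hy, hxy⟩ := exists_dist_lt hx hr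
    have h0 : 0 ≤ r := dist_nonneg.trans hxy.le
    refine Real.sSup_le ?_ (by positivity)
    rintro _ ⟨m, X, P, rfl⟩
    rw [← hx m P X, ← hy m P X]
    refine (randomVariables.abs_eval_sub_le P _ _).trans ?_
    have h1 : m ≤ n := by simpa using Fintype.card_le_of_injective X X.injective
    refine mul_le_mul (by exact_mod_cast h1) ?_ dist_nonneg (by positivity)
    exact (dist_pi_le_iff h0).2 fun i => (dist_le_pi_dist x y (X i)).trans hxy.le
  have hlim : Tendsto (fun r : ℝ => n * r) (𝓝[>] ((finiteProcesses.{u, v} S).dK a b))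
      (𝓝 (n * (finiteProcesses.{u, v} S).dK a b)) :=
    ((continuous_const.mul continuous_id).tendsto _).mono_left nhdsWithin_le_nhds
  exact ge_of_tendsto hlim (eventually_nhdsWithin_of_forall h)

theorem dK_le (a b : (finiteProcesses.{u, v} S).Enumerated n) :
    (finiteProcesses.{u, v} S).dK a b ≤ (Fintype.card S : ℝ) ^ n * fidiDist a b := by
  obtain ⟨x, hx⟩ := exists_tuple a
  have h0 := fidiDist_nonneg a b
  have hab : IsTupleEmbedding (a.tuple ∘ (Equiv.emptySum (Fin 0) (Fin n)) ∘ Sum.inl)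
      (b.tuple ∘ (Equiv.emptySum (Fin 0) (Fin n)) ∘ Sum.inl) :=
    a.mem.2.isTupleEmbedding_of_isEmpty b.mem.2 _ _
  obtain ⟨z, hz, -, hd⟩ := exists_near a b (Equiv.emptySum (Fin 0) (Fin n)) hx hab
  refine (dK_le_dist hx hz).trans (((dist_pi_le_iff (by positivity)).2 hd).trans ?_)
  have : 0 ≤ (Fintype.card S : ℝ) ^ n * fidiDist a b := by positivity
  linarith

theorem cp (S : Type v) [Fintype S] : (finiteProcesses.{u, v} S).CP := by
  intro n P a ε hε
  -- The Lipschitz constant is `n`; adding 1 covers `n = 0`.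
  refine ⟨ε / (n + 1), by positivity, fun b hb => ?_⟩
  have h0 : 0 ≤ (finiteProcesses.{u, v} S).dK a b := by
    refine Real.sInf_nonneg ?_
    rintro _ ⟨C, -, a', b', -, -, rfl⟩
    exact dist_nonneg
  rw [abs_sub_comm]
  calc _ ≤ n * (finiteProcesses.{u, v} S).dK a b :=
        (abs_eval_sub_le_dInf a b P).trans (dInf_le a b)
    _ ≤ (n + 1) * (finiteProcesses.{u, v} S).dK a b := by nlinarith
    _ < ε := by rwa [lt_div_iff₀' (by positivity)] at hb

theorem dK_self (a : (finiteProcesses.{u, v} S).Enumerated n) :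
    (finiteProcesses.{u, v} S).dK a a = 0 := by
  obtain ⟨x, hx⟩ := exists_tuple a
  refine le_antisymm ((dK_le_dist hx hx).trans_eq (dist_self x)) (Real.sInf_nonneg ?_)
  rintro _ ⟨C, -, a', b', -, -, rfl⟩
  exact dist_nonneg

theorem dK_comm (a b : (finiteProcesses.{u, v} S).Enumerated n) :
    (finiteProcesses.{u, v} S).dK a b = (finiteProcesses.{u, v} S).dK b a := by
  rw [StructureClass.dK, StructureClass.dK]
  congr 1
  ext r
  constructor <;>
  · rintro ⟨C, hC, a', b', ha, hb, rfl⟩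
    exact ⟨C, hC, b', a', hb, ha, dist_comm _ _⟩

theorem dK_triangle (a b c : (finiteProcesses.{u, v} S).Enumerated n) :
    (finiteProcesses.{u, v} S).dK a c ≤
      (finiteProcesses.{u, v} S).dK a b + (finiteProcesses.{u, v} S).dK b c := by
  obtain ⟨x, hx⟩ := exists_tuple a
  refine le_of_forall_pos_le_add fun ε hε => ?_
  obtain ⟨y, hy, hxy⟩ := exists_dist_lt hx (b := b) (lt_add_of_pos_right _ (half_pos hε))
  obtain ⟨z, hz, hyz⟩ := exists_dist_lt hy (b := c) (lt_add_of_pos_right _ (half_pos hε))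
  linarith [dK_le_dist hx hz, dist_triangle x y z]

variable (S n) in
/-- `d_K` as a pseudometric. -/
@[reducible] noncomputable def pseudoMetricSpace :
    PseudoMetricSpace ((finiteProcesses.{u, v} S).Enumerated n) where
  dist := (finiteProcesses.{u, v} S).dK
  dist_self := dK_self
  dist_comm := dK_comm
  dist_triangle := dK_triangle

/-- Up to d_K-distance 0, enumerated structures are the images of tuples of random variables under a
1-Lipschitz map, so separability passes down. For completeness, a rapidly Cauchy sequence is lifted
step by step to a Cauchy sequence of tuples, whose limit is projected back. -/
theorem pp (S : Type v) [Fintype S] : (finiteProcesses.{u, v} S).PP := by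
  intro n
  let _ := pseudoMetricSpace.{u, v} S n
  have hdist (a b : (finiteProcesses.{u, v} S).Enumerated n) :
    dist a b = (finiteProcesses.{u, v} S).dK a b := rfl
  refine ⟨pseudoMetricSpace S n, fun _ _ => rfl, ?_, ?_⟩
  · have hcont : Continuous (enumerated (S := S) (n := n)) :=
      (LipschitzWith.of_dist_le_mul (K := 1) fun x y => by
        rw [NNReal.coe_one, one_mul]
        exact dK_le_dist (isTupleEmbedding_enumerated x)
          (isTupleEmbedding_enumerated y)).continuous
    have hdense : DenseRange (enumerated (S := S) (n := n)) := by
      refine Metric.denseRange_iff.2 fun a r hr => ?_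
      obtain ⟨x, hx⟩ := exists_tuple a
      exact ⟨x, ((dK_le_dist hx (isTupleEmbedding_enumerated x)).trans_eq (dist_self x)).trans_lt hr⟩
    exact hdense.separableSpace hcont
  · refine Metric.complete_of_convergent_controlled_sequences (fun n => (1 / 2 : ℝ) ^ n)
      (fun n => by positivity) fun a ha => ?_
    have hstep : ∀ k (x : {x : Fin n → randomVariables.{u, v} S // IsTupleEmbedding (a k).tuple x}),
        ∃ y : {x : Fin n → randomVariables.{u, v} S // IsTupleEmbedding (a (k + 1)).tuple x},
          dist x.1 y.1 < (1 / 2) ^ k := by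
      intro k x
      obtain ⟨y, hy, hxy⟩ := exists_dist_lt x.2 (ha k k (k + 1) le_rfl (Nat.le_succ k))
      exact ⟨⟨y, hy⟩, hxy⟩
    choose next hnext using hstep
    obtain ⟨x₀, hx₀⟩ := exists_tuple (a 0)
    let x : ∀ k, {x : Fin n → randomVariables.{u, v} S // IsTupleEmbedding (a k).tuple x} :=
      fun k => Nat.rec ⟨x₀, hx₀⟩ next k
    have hcauchy : CauchySeq fun k => (x k).1 :=
      cauchySeq_of_le_geometric (1 / 2) 1 (by norm_num) fun k => by
        rw [one_mul]; exact (hnext k (x k)).le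
    obtain ⟨y, hy⟩ := cauchySeq_tendsto_of_complete hcauchy
    refine ⟨enumerated y, tendsto_iff_dist_tendsto_zero.2 ?_⟩
    refine squeeze_zero (fun _ => dist_nonneg) (fun k => ?_) (tendsto_iff_dist_tendsto_zero.1 hy)
    exact dK_le_dist (x k).2 (isTupleEmbedding_enumerated y)

theorem isFraisseClass (S : Type v) [Fintype S] : (finiteProcesses.{u, v} S).IsFraisseClass where
  finite _ hA := hA.1
  hp := hp S
  jep := jep S
  ap := ap S
  pp := pp S
  cp := cp S

end finiteProcesses

/-! ### Limits of embeddings and back-and-forth -/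

namespace MetricStructure

variable {L : ℕ → Type v} {M N : MetricStructure.{u, v} L}

theorem continuous_eval (M : MetricStructure.{u, v} L) {n : ℕ} (P : PredSymbol L n) :
    Continuous (M.eval P) := by
  cases P with
  | rel R => exact (M.uniformContinuous_interp R).continuous
  | d => exact (continuous_apply 0).dist (continuous_apply 1)

theorem isEmbedding_of_tendsto {f : ℕ → M → N} (hf : ∀ k, IsEmbedding (f k)) {g : M → N}
    (h : ∀ a, Tendsto (fun k => f k a) atTop (𝓝 (g a))) : IsEmbedding g := by
  intro n P t
  have h1 : Tendsto (fun k => f k ∘ t) atTop (𝓝 (g ∘ t)) := tendsto_pi_nhds.2 fun i => h (t i)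
  refine tendsto_nhds_unique (((N.continuous_eval P).tendsto _).comp h1) ?_
  simp only [Function.comp_def (N.eval P)]
  simp only [hf _ n P t]
  exact tendsto_const_nhds

/-- A map between dense families that preserves all predicates extends to an embedding. -/
theorem IsTupleEmbedding.exists_isEmbedding {ι : Type*} {x : ι → M} {y : ι → N}
    (h : IsTupleEmbedding x y) (hx : DenseRange x) :
    ∃ f : M → N, IsEmbedding f ∧ ∀ i, f (x i) = y i := by
  have hseq : ∀ m : M, ∃ i : ℕ → ι, Tendsto (fun k => x (i k)) atTop (𝓝 m) := by
    intro m
    obtain ⟨s, hs, hsm⟩ := mem_closure_iff_seq_limit.1 (hx m)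
    choose i hi using hs
    exact ⟨i, by simpa only [hi] using hsm⟩
  choose i hi using hseq
  have hc : ∀ m, ∃ b, Tendsto (fun k => y (i m k)) atTop (𝓝 b) := by
    intro m
    refine cauchySeq_tendsto_of_complete (Metric.cauchySeq_iff'.2 fun ε hε => ?_)
    obtain ⟨n, hn⟩ := Metric.cauchySeq_iff'.1 (hi m).cauchySeq ε hε
    exact ⟨n, fun k hk => by rw [h.dist_eq]; exact hn k hk⟩
  choose f hf using hc
  refine ⟨f, fun n P t => ?_, fun j => ?_⟩
  · have h1 : Tendsto (fun k => y ∘ fun j => i (t j) k) atTop (𝓝 (f ∘ t)) :=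
      tendsto_pi_nhds.2 fun j => hf (t j)
    have h2 : Tendsto (fun k => x ∘ fun j => i (t j) k) atTop (𝓝 t) :=
      tendsto_pi_nhds.2 fun j => hi (t j)
    refine tendsto_nhds_unique (((N.continuous_eval P).tendsto _).comp h1) ?_
    simp only [Function.comp_def (N.eval P), h n P]
    exact ((M.continuous_eval P).tendsto _).comp h2
  · refine tendsto_nhds_unique (hf (x j)) (tendsto_iff_dist_tendsto_zero.2 ?_)
    simp only [h.dist_eq]
    exact tendsto_iff_dist_tendsto_zero.1 (hi (x j))

/-- The isometric image of a complete space is closed. -/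
theorem IsEmbedding.isIsomorphism {f : M → N} (hf : IsEmbedding f) (hd : DenseRange f) :
    IsIsomorphism f := by
  refine ⟨hf, fun b => ?_⟩
  have h := hf.isometry.isClosedEmbedding.isClosed_range
  exact h.closure_subset (hd b)

end MetricStructure

/-- The finite partial isomorphisms from `M` to `N`, as graphs. -/
def FinitePartialIso {L : ℕ → Type v} (M N : MetricStructure.{u, v} L) : Type u :=
  {p : Set (M × N) // p.Finite ∧ IsTupleEmbedding (fun q : p => q.1.1) fun q : p => q.1.2}

namespace FinitePartialIso

variable {L : ℕ → Type v} {M N : MetricStructure.{u, v} L} {K : StructureClass.{u, v} L}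

instance : Preorder (FinitePartialIso M N) :=
  Preorder.lift Subtype.val

def swap (p : FinitePartialIso M N) : FinitePartialIso N M :=
  ⟨Prod.swap ⁻¹' p.1, p.2.1.preimage Prod.swap_injective.injOn,
    p.2.2.symm.comp fun q : ↥(Prod.swap ⁻¹' p.1) => (⟨q.1.swap, q.2⟩ : p.1)⟩

/-- The domain of `p` together with `m` carries a finite substructure of `M`, hence a member of `K`,
to which the extension property of `N` applies. -/
theorem exists_extension_left (hM : K.IsStructure M) (hN : K.ExactExtension N)
    (p : FinitePartialIso M N) (m : M) :
    ∃ p' : FinitePartialIso M N, p ≤ p' ∧ ∃ n, (m, n) ∈ p'.1 := by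
  obtain ⟨p, hp, hpe⟩ := p
  have hA : (insert m (Prod.fst '' p)).Finite := (hp.image _).insert m
  have := hp.to_subtype
  obtain ⟨k, ⟨e⟩⟩ := Finite.exists_equiv_fin p
  let D := M.restrict _ hA
  let a : p → D := fun q => (⟨q.1.1, Or.inr ⟨q.1, q.2, rfl⟩⟩ : ↥(insert m (Prod.fst '' p)))
  have ha : IsTupleEmbedding a fun q : p => q.1.2 :=
    (isTupleEmbedding_restrict M _ hA (fun q : p => q.1.1) _).symm.trans hpe
  obtain ⟨f, hf, hfa⟩ := hN D (hM D hA.to_subtype ⟨_, isEmbedding_val M _ hA⟩) k (a ∘ e.symm)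
    ((fun q : p => q.1.2) ∘ e.symm) (ha.comp e.symm)
  let m' : D := (⟨m, Or.inl rfl⟩ : ↥(insert m (Prod.fst '' p)))
  have hgraph : ∀ q : ↥(insert (m, f m') p), ∃ d : D, d.1 = q.1.1 ∧ f d = q.1.2 := by
    rintro ⟨q, rfl | hq⟩
    · exact ⟨m', rfl, rfl⟩
    · exact ⟨a ⟨q, hq⟩, rfl, by simpa using hfa (e ⟨q, hq⟩)⟩
  choose d hd hfd using hgraph
  refine ⟨⟨insert (m, f m') p, hp.insert _, ?_⟩, subset_insert _ _, f m', Or.inl rfl⟩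
  have h1 := ((isEmbedding_val M _ hA).isTupleEmbedding d).symm.trans (hf.isTupleEmbedding d)
  convert h1 using 1
  · exact funext fun q => (hd q).symm
  · exact funext fun q => (hfd q).symm

theorem exists_extension_right (hN : K.IsStructure N) (hM : K.ExactExtension M)
    (p : FinitePartialIso M N) (n : N) :
    ∃ p' : FinitePartialIso M N, p ≤ p' ∧ ∃ m, (m, n) ∈ p'.1 := by
  obtain ⟨p', hp, m, hm⟩ := exists_extension_left hN hM p.swap n
  exact ⟨p'.swap, fun q hq => hp (a := q.swap) hq, m, hm⟩

/-- The union of a chain of finite partial isomorphisms that meets countably many cofinal sets. -/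
theorem exists_union (p : FinitePartialIso M N) {ι : Type*} [Encodable ι]
    (D : ι → Order.Cofinal (FinitePartialIso M N)) :
    ∃ U : Set (M × N), p.1 ⊆ U ∧ IsTupleEmbedding (fun q : U => q.1.1) (fun q : U => q.1.2) ∧
      ∀ i, ∃ p' ∈ D i, p'.1 ⊆ U := by
  let I := Order.sequenceOfCofinals p D
  refine ⟨⋃ k, (I k).1, subset_iUnion (fun k => (I k).1) 0, ?_, fun i => ?_⟩
  · intro n P j
    choose k hk using fun l : Fin n => mem_iUnion.1 (j l).2
    -- A predicate sees finitely many points of the union, and these all lie in one stage of the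
    -- chain.
    have hj : ∀ l, (j l).1 ∈ (I (Finset.univ.sup k)).1 := fun l =>
      Order.sequenceOfCofinals.monotone p D (Finset.le_sup (Finset.mem_univ l)) (hk l)
    exact (I (Finset.univ.sup k)).2.2 n P fun l => ⟨(j l).1, hj l⟩
  · exact ⟨_, Order.sequenceOfCofinals.encode_mem p D i, subset_iUnion (fun k => (I k).1) _⟩

/-- Going forth. -/
theorem exists_isEmbedding (hs : TopologicalSpace.SeparableSpace M) (hM : K.IsStructure M)
    (hN : K.ExactExtension N) (p : FinitePartialIso M N) :
    ∃ f : M → N, IsEmbedding f ∧ ∀ q ∈ p.1, f q.1 = q.2 := by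
  obtain ⟨s, hsc, hsd⟩ := TopologicalSpace.exists_countable_dense M
  have := hsc.to_subtype
  let _ := Encodable.ofCountable s
  obtain ⟨U, hpU, hU, hD⟩ := p.exists_union fun m : s =>
    ⟨{p' | ∃ n, (m.1, n) ∈ p'.1}, fun p' =>
      let ⟨q, h1, h2⟩ := exists_extension_left hM hN p' m.1
      ⟨q, h2, h1⟩⟩
  obtain ⟨f, hf, hfU⟩ := hU.exists_isEmbedding (hsd.mono fun m hm => by
    obtain ⟨p', ⟨n, hn⟩, hpU⟩ := hD ⟨m, hm⟩
    exact ⟨⟨_, hpU hn⟩, rfl⟩)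
  exact ⟨f, hf, fun q hq => hfU ⟨q, hpU hq⟩⟩

/-- Going back and forth. -/
theorem exists_isIsomorphism (hM : K.IsExactLimit M) (hN : K.IsExactLimit N)
    (p : FinitePartialIso M N) :
    ∃ f : M → N, IsIsomorphism f ∧ ∀ q ∈ p.1, f q.1 = q.2 := by
  have := hM.separable
  have := hN.separable
  obtain ⟨s, hsc, hsd⟩ := TopologicalSpace.exists_countable_dense M
  obtain ⟨t, htc, htd⟩ := TopologicalSpace.exists_countable_dense N
  have := hsc.to_subtype
  have := htc.to_subtype
  let _ := Encodable.ofCountable (s ⊕ t)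
  obtain ⟨U, hpU, hU, hD⟩ := p.exists_union (Sum.elim
    (fun m : s => ⟨{p' | ∃ n, (m.1, n) ∈ p'.1}, fun p' =>
      let ⟨q, h1, h2⟩ := exists_extension_left hM.isStructure hN.extension p' m.1
      ⟨q, h2, h1⟩⟩)
    (fun n : t => ⟨{p' | ∃ m, (m, n.1) ∈ p'.1}, fun p' =>
      let ⟨q, h1, h2⟩ := exists_extension_right hN.isStructure hM.extension p' n.1
      ⟨q, h2, h1⟩⟩))
  obtain ⟨f, hf, hfU⟩ := hU.exists_isEmbedding (hsd.mono fun m hm => by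
    obtain ⟨p', ⟨n, hn⟩, hpU⟩ := hD (Sum.inl ⟨m, hm⟩)
    exact ⟨⟨_, hpU hn⟩, rfl⟩)
  refine ⟨f, hf.isIsomorphism (htd.mono fun n hn => ?_), fun q hq => hfU ⟨q, hpU hq⟩⟩
  obtain ⟨p', ⟨m, hm⟩, hpU⟩ := hD (Sum.inr ⟨n, hn⟩)
  exact ⟨m, hfU ⟨_, hpU hm⟩⟩

end FinitePartialIso

theorem StructureClass.IsExactLimit.isUltrahomogeneous {L : ℕ → Type v}
    {K : StructureClass.{u, v} L} {M : MetricStructure.{u, v} L} (hM : K.IsExactLimit M) :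
    M.IsUltrahomogeneous := by
  intro A hA φ hφ
  have := hA.to_subtype
  have hg : ∀ q : range fun a : A => (a.1, φ a), ∃ a : A, (a.1, φ a) = q.1 := fun q => q.2
  choose a ha using hg
  let p : FinitePartialIso M M := ⟨range fun a : A => (a.1, φ a), finite_range _, by
    convert hφ.comp a using 1
    · exact funext fun q => congrArg Prod.fst (ha q).symm
    · exact funext fun q => congrArg Prod.snd (ha q).symm⟩
  obtain ⟨f, hf, hfp⟩ := FinitePartialIso.exists_isIsomorphism hM hM p
  exact ⟨f, hf, fun a => hfp (a.1, φ a) ⟨a, rfl⟩⟩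

/-! ### Approximate limits are exact; universality and uniqueness -/

namespace randomVariables

variable {S : Type v} [Fintype S]

/-- The easy half of the coupling inequality: the part of {x = s} outside {y = s} lies where `x` and
`y` differ, and these parts are disjoint for distinct `s`. -/
theorem sum_max_law_sub_le {ι : Type*} [Fintype ι] [DecidableEq ι]
    (x y : ι → randomVariables.{u, v} S) :
    ∑ s, max ((randomVariables.{u, v} S).law x s - (randomVariables.{u, v} S).law y s) 0 ≤
      unitMeasure.real {ω | ∃ j, rv (x j) ω ≠ rv (y j) ω} := by
  rw [← (IsRandomVariable.pi fun j => isRandomVariable_rv (x j)).sum_measure_inter]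
  refine Finset.sum_le_sum fun s _ => max_le ?_ measureReal_nonneg
  rw [law_eq, law_eq, sub_le_iff_le_add']
  refine (measureReal_mono fun ω hω => ?_).trans (measureReal_union_le _ _)
  by_cases h : ∀ j, rv (x j) ω = rv (y j) ω
  · exact Or.inl fun j => (h j).symm.trans (hω j)
  · exact Or.inr ⟨not_forall.1 h, funext hω⟩

/-- An embedding in the process of all random variables can be moved to one with prescribed values
on a subfamily, by no more than the sum of the prescribed moves. -/
theorem exists_embedding_near {B : MetricStructure.{u, v} (processLanguage S)}
    (hB : B ∈ finiteProcesses.{u, v} S) {n : ℕ} {a : Fin n → B}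
    {x : Fin n → randomVariables.{u, v} S} (h : IsTupleEmbedding a x)
    {w : B → randomVariables.{u, v} S} (hw : IsEmbedding w) :
    ∃ z : B → randomVariables.{u, v} S, IsEmbedding z ∧ (∀ i, z (a i) = x i) ∧
      ∀ b, dist (w b) (z b) ≤ ∑ i, dist (w (a i)) (x i) := by
  classical
  have := hB.1
  have := Fintype.ofFinite B
  obtain ⟨z, hz, hd⟩ := exists_coupling hB.2 w id h
  refine ⟨z, (hz.comp Sum.inr).isEmbedding, fun i => ?_, fun b => ?_⟩
  · have h1 := hz.dist_eq (Sum.inr (a i)) (Sum.inl i)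
    simpa using h1
  · refine (dist_le_measure_exists_ne w z b).trans (hd.trans ?_)
    -- The prescribed law is already realised by `w` itself. The cost therefore compares `(x, w)`
    -- with `(w ∘ a, w)`, which differ only in the first block; hence the sum over `i`.
    have h1 : ∀ v, B.law (Sum.elim a id) v =
        (randomVariables.{u, v} S).law (Sum.elim (w ∘ a) w) v := by
      intro v
      rw [← (hw.isTupleEmbedding (Sum.elim a id)).law_eq, Sum.comp_elim]
      rfl
    simp only [h1]
    refine (sum_max_law_sub_le (Sum.elim x w) (Sum.elim (w ∘ a) w)).trans ?_
    have h2 : {ω | ∃ j, rv (Sum.elim x w j) ω ≠ rv (Sum.elim (w ∘ a) w j) ω} =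
        {ω | ∃ i, rv (w (a i)) ω ≠ rv (x i) ω} := by
      ext ω; simp [eq_comm]
    rw [h2]
    refine (unitMeasure_exists_le _).trans ?_
    simp only [← dist_eq, le_refl]

theorem exactExtension :
    (finiteProcesses.{u, v} S).ExactExtension (randomVariables.{u, v} S) :=
  fun _ hB _ _ _ h => exists_embedding hB h

theorem isExactLimit : (finiteProcesses.{u, v} S).IsExactLimit (randomVariables.{u, v} S) where
  separable := inferInstance
  isStructure := isNondegenerateProcess.isStructure
  extension := exactExtension

end randomVariables

namespace finiteProcesses

open randomVariables

variable {S : Type v} [Fintype S] {B N : MetricStructure.{u, v} (processLanguage S)}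

/-- An embedding that extends `h` with a small error can be changed to one with an even smaller
error by a small move. -/
theorem exists_closer_embedding (hN : IsNondegenerateProcess N)
    (hext : (finiteProcesses.{u, v} S).ApproxExtension N) (hB : B ∈ finiteProcesses.{u, v} S)
    {n : ℕ} {a : Fin n → B} {h : Fin n → N} (hah : IsTupleEmbedding a h) {f : B → N}
    (hf : IsEmbedding f) {ε δ : ℝ} (hε : ∀ i, dist (f (a i)) (h i) ≤ ε) (hδ : 0 < δ) :
    ∃ f' : B → N, IsEmbedding f' ∧ (∀ i, dist (f' (a i)) (h i) ≤ δ) ∧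
      ∀ b, dist (f b) (f' b) ≤ n * ε + δ := by
  classical
  have := hB.1
  have := Fintype.ofFinite B
  -- The finite configuration of `h` and `f` is copied into the random variables, where `f` is
  -- corrected to an exact extension `z` of the copy of `h`.
  have hC : (range h ∪ range f).Finite := (finite_range h).union (finite_range f)
  let D := N.restrict _ hC
  let h' : Fin n → D := fun i => (⟨h i, Or.inl ⟨i, rfl⟩⟩ : ↥(range h ∪ range f))
  let f' : B → D := fun b => (⟨f b, Or.inr ⟨b, rfl⟩⟩ : ↥(range h ∪ range f))
  have : Finite D := hC.to_subtype
  have hh' : IsTupleEmbedding h h' := isTupleEmbedding_restrict N _ hC h _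
  have hf' : IsEmbedding f' := hf.codRestrict _ hC _
  obtain ⟨g, hg⟩ := exists_embedding_of_mem (hN.restrict_mem _ hC)
  have hM : IsNondegenerateProcess (randomVariables.{u, v} S) := isNondegenerateProcess
  obtain ⟨z, hzE, hzi, hd⟩ := exists_embedding_near hB
    (hah.trans (hh'.trans (hg.isTupleEmbedding h'))) (hg.comp hf')
  have hdz : ∀ b, dist (g (f' b)) (z b) ≤ n * ε := by
    intro b
    refine (hd b).trans ((Finset.sum_le_card_nsmul _ _ ε fun i _ => ?_).trans (by simp))
    have h1 : dist (g (f' (a i))) (g (h' i)) = dist (f' (a i)) (h' i) := hg.isometry.dist_eq _ _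
    exact h1.trans_le (hε i)
  have hE : (range g ∪ range z).Finite := (finite_range g).union (finite_range z)
  let E := (randomVariables.{u, v} S).restrict _ hE
  let g' : D → E := fun d => (⟨g d, Or.inl ⟨d, rfl⟩⟩ : ↥(range g ∪ range z))
  let z' : B → E := fun b => (⟨z b, Or.inr ⟨b, rfl⟩⟩ : ↥(range g ∪ range z))
  have hg' : IsEmbedding g' := hg.codRestrict _ hE _
  have hz' : IsEmbedding z' := hzE.codRestrict _ hE _
  obtain ⟨k, ⟨e⟩⟩ := Finite.exists_equiv_fin D
  -- The configuration with the correction returns to `N`, its original points being displaced by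
  -- less than `δ`. On `a` the corrected map inherits just this error; elsewhere the move `n * ε` is
  -- added.
  obtain ⟨F, hF, hFg⟩ := hext E (hM.restrict_mem _ hE) k (g' ∘ e.symm)
    ((fun d : D => d.1) ∘ e.symm)
    ((hg'.isTupleEmbedding (e.symm : Fin k → D)).symm.trans
      ((isEmbedding_val N _ hC).isTupleEmbedding _)) δ hδ
  have hFg' : ∀ d : D, dist (F (g' d)) d.1 < δ := fun d => by
    have h1 := hFg (e d)
    rwa [Function.comp_apply, Function.comp_apply, e.symm_apply_apply] at h1
  refine ⟨F ∘ z', hF.comp hz', fun i => ?_, fun b => ?_⟩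
  · have h1 : z' (a i) = g' (h' i) := Subtype.ext (hzi i)
    rw [Function.comp_apply, h1]
    exact (hFg' (h' i)).le
  · have h1 : dist (F (g' (f' b))) (F (z' b)) ≤ n * ε := by
      rw [hF.isometry.dist_eq]
      exact hdz b
    have h2 := hFg' (f' b)
    rw [dist_comm] at h2
    have h3 : dist (f b) (F (z' b)) ≤ dist (f b) (F (g' (f' b))) + dist (F (g' (f' b))) (F (z' b)) :=
      dist_triangle _ _ _
    have h4 : dist (f b) (F (g' (f' b))) < δ := h2
    exact h3.trans (by linarith)

/-- Approximate limits are exact limits. -/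
theorem isExactLimit_of_isApproxLimit (hN : (finiteProcesses.{u, v} S).IsApproxLimit N) :
    (finiteProcesses.{u, v} S).IsExactLimit N where
  separable := hN.separable
  isStructure := hN.isStructure
  extension := by
    intro B hB n a h hah
    have hNp := IsNondegenerateProcess.of_isStructure hN.isStructure
    have hpos : ∀ k : ℕ, (0 : ℝ) < (1 / 2) ^ k := fun k => by positivity
    -- Halving the error costs a move of at most n 2⁻ᵏ + 2⁻ᵏ⁻¹, which is summable; the maps converge
    -- pointwise and the error on `a` tends to 0.
    have hstep : ∀ k (f : {f : B → N // IsEmbedding f ∧ ∀ i, dist (f (a i)) (h i) ≤ (1 / 2) ^ k}),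
        ∃ f' : {f : B → N // IsEmbedding f ∧ ∀ i, dist (f (a i)) (h i) ≤ (1 / 2) ^ (k + 1)},
          ∀ b, dist (f.1 b) (f'.1 b) ≤ (n + 1) * (1 / 2) ^ k := by
      intro k f
      obtain ⟨f', hf', hf'a, hff'⟩ := exists_closer_embedding hNp hN.extension hB hah f.2.1 f.2.2
        (hpos (k + 1))
      refine ⟨⟨f', hf', hf'a⟩, fun b => (hff' b).trans ?_⟩
      rw [pow_succ]
      linarith [hpos k]
    choose next hnext using hstep
    obtain ⟨f₀, hf₀, hf₀a⟩ := hN.extension B hB n a h hah 1 one_pos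
    let f : ∀ k, {f : B → N // IsEmbedding f ∧ ∀ i, dist (f (a i)) (h i) ≤ (1 / 2) ^ k} :=
      fun k => Nat.rec ⟨f₀, hf₀, fun i => by simpa using (hf₀a i).le⟩ next k
    have hlim : ∀ b, ∃ c, Tendsto (fun k => (f k).1 b) atTop (𝓝 c) := fun b =>
      cauchySeq_tendsto_of_complete (cauchySeq_of_le_geometric (1 / 2) (n + 1) (by norm_num)
        fun k => hnext k (f k) b)
    choose g hg using hlim
    refine ⟨g, isEmbedding_of_tendsto (fun k => (f k).2.1) hg, fun i => ?_⟩
    refine tendsto_nhds_unique (hg (a i)) (tendsto_iff_dist_tendsto_zero.2 ?_)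
    exact squeeze_zero (fun _ => dist_nonneg) (fun k => (f k).2.2 i)
      (tendsto_pow_atTop_nhds_zero_of_lt_one (by norm_num) (by norm_num))

/-- The empty partial isomorphism. -/
def emptyPartialIso (hB : IsNondegenerateProcess B) (hN : IsNondegenerateProcess N) :
    FinitePartialIso B N :=
  ⟨∅, finite_empty, hB.isTupleEmbedding_of_isEmpty hN _ _⟩

theorem isUniversal_of_isExactLimit (hN : (finiteProcesses.{u, v} S).IsExactLimit N) :
    (finiteProcesses.{u, v} S).IsUniversal N := by
  intro M hs hM
  obtain ⟨f, hf, -⟩ := FinitePartialIso.exists_isEmbedding hs hM hN.extension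
    (emptyPartialIso (.of_isStructure hM) (.of_isStructure hN.isStructure))
  exact ⟨f, hf⟩

theorem exists_isIsomorphism (hB : (finiteProcesses.{u, v} S).IsExactLimit B)
    (hN : (finiteProcesses.{u, v} S).IsExactLimit N) : ∃ φ : B → N, IsIsomorphism φ := by
  obtain ⟨f, hf, -⟩ := FinitePartialIso.exists_isIsomorphism hB hN
    (emptyPartialIso (.of_isStructure hB.isStructure) (.of_isStructure hN.isStructure))
  exact ⟨f, hf⟩

end finiteProcesses

theorem mainTheorem5 (S : Type v) [Fintype S] :
    ((finiteProcesses.{u, v} S).HP ∧ (finiteProcesses.{u, v} S).JEP ∧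
      (finiteProcesses.{u, v} S).BAP ∧ (finiteProcesses.{u, v} S).PP ∧
      (finiteProcesses.{u, v} S).CP) ∧
    (finiteProcesses.{u, v} S).IsFraisseClass ∧
    (∀ n : ℕ, (finiteProcesses.{u, v} S).BoundedAmalgamation n
      (fun x y => 1 / 2 * (Fintype.card S : ℝ) ^ (n + 1) * fidiDist x y)) ∧
    (∀ (n : ℕ) (a b : (finiteProcesses.{u, v} S).Enumerated n),
      fidiDist a b ≤ StructureClass.dInf a b ∧
      StructureClass.dInf a b ≤ n * (finiteProcesses.{u, v} S).dK a b ∧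
      (finiteProcesses.{u, v} S).dK a b ≤ (Fintype.card S : ℝ) ^ n * fidiDist a b) ∧
    (∃ M : MetricStructure.{u, v} (processLanguage S),
      (finiteProcesses.{u, v} S).IsExactLimit M ∧
      M.IsUltrahomogeneous ∧
      (finiteProcesses.{u, v} S).IsUniversal M ∧
      ∀ N : MetricStructure.{u, v} (processLanguage S),
        (finiteProcesses.{u, v} S).IsApproxLimit N →
        ∃ φ : M → N, MetricStructure.IsIsomorphism φ) :=
  ⟨⟨finiteProcesses.hp S, finiteProcesses.jep S, finiteProcesses.bap S, finiteProcesses.pp S,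
      finiteProcesses.cp S⟩,
    finiteProcesses.isFraisseClass S, finiteProcesses.boundedAmalgamation S,
    fun _ a b => ⟨finiteProcesses.fidiDist_le_dInf a b, finiteProcesses.dInf_le a b,
      finiteProcesses.dK_le a b⟩,
    randomVariables S, randomVariables.isExactLimit, randomVariables.isExactLimit.isUltrahomogeneous,
    finiteProcesses.isUniversal_of_isExactLimit randomVariables.isExactLimit,
    fun _ hN => finiteProcesses.exists_isIsomorphism randomVariables.isExactLimit
      (finiteProcesses.isExactLimit_of_isApproxLimit hN)⟩
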